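/- Let $m\ge 2$ and $n_1,\dots,n_m\ge 1$ be integers. For an array $a=(a_{j_1\cdots j_m})$ $(1\le j_k\le n_k)$ of complex numbers of modulus $1$ put $$s(a)=\sup\Big\{\Big|\sum_{j_1=1}^{n_1}\cdots\sum_{j_m=1}^{n_m}a_{j_1\cdots j_m}x^{(1)}_{j_1}\cdots x^{(m)}_{j_m}\Big| : x^{(k)}_{j}\in\mathbb C,\ |x^{(k)}_{j}|=1\Big\},\qquad S^{\mathbb C}_{n_1\dots n_m}=\min_a s(a),$$ the minimum being over all such arrays $a$. The minimum is attained, and $S^{\mathbb C}_{n_1\dots n_m}$ is also the minimum, over all such arrays $a$, of the norm $\|A\|$ of the $m$-linear form $A:\ell_\infty^{n_1}\times\cdots\times\ell_\infty^{n_m}\to\mathbb C$ with coefficients $a_{j_1\cdots j_m}$. Moreover $$\Big(\frac{\sqrt\pi}{2}\Big)^{m-1}\le\frac{S^{\mathbb C}_{n_1\dots n_m}}{\sqrt{n_1\cdots n_m}\,\max\{\sqrt{n_1},\dots,\sqrt{n_m}\}}\le 1,$$ and the universal upper bound $1$ cannot be improved: for every $m\ge2$, if a real number $C$ is such that the quotient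 above is at most $C$ for all $n_1,\dots,n_m\ge1$, then $C\ge 1$. -/

import Mathlib

namespace SwitchingGame

/-- An `n 0 × ⋯ × n (m-1)` pattern of unit vectors of the plane, i.e. of complex numbers of
modulus one. -/
abbrev Pattern {m : ℕ} (n : Fin m → ℕ) : Type := ((k : Fin m) → Fin (n k)) → Circle

/-- A position of all the knobs: for every direction `k` and every `i : Fin (n k)`, a rotation
of the plane, i.e. multiplication by a complex number of modulus one. -/
abbrev Knobs {m : ℕ} (n : Fin m → ℕ) : Type := (k : Fin m) → Fin (n k) → Circle

/-- The sum of all the vectors of the pattern `a` after the rotations `x`: the vector at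
`j = (j₁, …, jₘ)` is rotated by each of the `m` knobs that act on it. -/
noncomputable def total {m : ℕ} {n : Fin m → ℕ} (a : Pattern n) (x : Knobs n) : ℂ :=
  ∑ j : (k : Fin m) → Fin (n k), (a j : ℂ) * ∏ k, (x k (j k) : ℂ)

/-- `s(Θ)`: the supremum of the Euclidean norms of the sums achievable from a pattern. -/
noncomputable def patternValue {m : ℕ} {n : Fin m → ℕ} (a : Pattern n) : ℝ :=
  ⨆ x : Knobs n, ‖total a x‖

/-- The extremal number `S^ℂ` of the game: the least value of a pattern. -/
noncomputable def gameValue {m : ℕ} (n : Fin m → ℕ) : ℝ :=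
  ⨅ a : Pattern n, patternValue a

/-- The `m`-linear form on `ℓ_∞^{n 0} × ⋯ × ℓ_∞^{n (m-1)}` with the coefficients `a`
(the norm of `Fin (n k) → ℂ` is the sup norm). -/
noncomputable def form {m : ℕ} {n : Fin m → ℕ} (a : Pattern n) :
    ContinuousMultilinearMap ℂ (fun k : Fin m => Fin (n k) → ℂ) ℂ :=
  ∑ j : (k : Fin m) → Fin (n k), (a j : ℂ) •
    (ContinuousMultilinearMap.mkPiAlgebra ℂ (Fin m) ℂ).compContinuousLinearMap
      (fun k => ContinuousLinearMap.proj (R := ℂ) (φ := fun _ : Fin (n k) => ℂ) (j k))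

theorem form_apply {m : ℕ} {n : Fin m → ℕ} (a : Pattern n) (x : (k : Fin m) → Fin (n k) → ℂ) :
    form a x = ∑ j : (k : Fin m) → Fin (n k), (a j : ℂ) * ∏ k, x k (j k) := by
  simp [form]

/-- The normalized extremal number
`S^ℂ / (√(n 0 ⋯ n (m-1)) · max {√(n 0), …, √(n (m-1))})`. -/
noncomputable def ratio {m : ℕ} (n : Fin m → ℕ) : ℝ :=
  gameValue n / (√(∏ k, (n k : ℝ)) * ⨆ k, √(n k : ℝ))

end SwitchingGame

/-! Upper bound. Arrange the sides in decreasing order and chain Fourier matrices: `a_j = ω_0^(j_0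
j_1) ω_1^(j_1 j_2) ⋯` with `ω_k` a primitive `n_k`-th root of unity. As `n_(k+1) ≤ n_k`, each factor
is a block of a Fourier matrix with orthogonal columns, so it multiplies the squared `ℓ²` norm by
exactly `n_k`, whatever the knobs. Cauchy–Schwarz along the longest direction gives `√(∏ n_k) √n_0`.
When all sides are 1 the quotient equals 1, so the constant is sharp.

Lower bound. Choose the knobs of every direction but one, of maximal length, at random, one
direction after another, as independent Steinhaus variables. Khinchin's inequality `E|∑ c_k z_k| ≥
(√π/2) (∑ |c_k|²)^(1/2)` (`steinhaus_khinchin`), in its `ℓ²`-valued form, costs a factor `√π/2` per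
direction. The knobs of the remaining direction align the phases.

Most of the work is the sharp Khinchin inequality, by Haagerup's method. The starting point is `E|S|
= ∫ (1 - ∏ J₀(t|c_k|)) dt/t²` over `(0, ∞)`, with `∑ |c_k|² = 1`. If all `|c_k|²` are at most
`1/1.9`, weighted AM-GM separates the variables and leaves `∫ (1 - |J₀(u)|^(2q)) du/u² ≥ √(πq/2)`
with `q = 1/(2|c_k|²) ≥ 0.95` (`sqrt_le_integral_one_sub_besselJ0_sq_rpow`). If some `|c_i|²` is
larger, average over `z_i` first, bound that average below by a polynomial in `|S'|²`, where `S'` is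
the rest of the sum, and use the second and fourth moments of `S'`.

The supremum over the torus is the multilinear norm, because a point of the closed disc is the
midpoint of two points of the circle. The minimum is attained by compactness. -/

namespace SwitchingGame

open Real MeasureTheory

/-! ### Taylor bounds and estimates for the Bessel functions `J₀` and `J₁` -/

/-- The Taylor polynomials of cosine and sine alternately over- and underestimate them. -/
theorem cos_sin_taylor_alternating (n : ℕ) : ∀ x : ℝ, 0 ≤ x →
    0 ≤ (-1) ^ (n + 1) * (cos x - ∑ k ∈ Finset.range (n + 1),
      (-1) ^ k * x ^ (2 * k) / (2 * k).factorial) ∧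
    0 ≤ (-1) ^ (n + 1) * (sin x - ∑ k ∈ Finset.range (n + 1),
      (-1) ^ k * x ^ (2 * k + 1) / (2 * k + 1).factorial) := by
  have nonneg_of_deriv : ∀ f f' : ℝ → ℝ, (∀ x, HasDerivAt f (f' x) x) → f 0 = 0 →
      (∀ x, 0 ≤ x → 0 ≤ f' x) → ∀ x, 0 ≤ x → 0 ≤ f x := by
    intro f f' hf h0 hf' x hx
    have hmono : MonotoneOn f (Set.Ici 0) := by
      apply monotoneOn_of_deriv_nonneg (convex_Ici 0)
        (fun y _ => (hf y).continuousAt.continuousWithinAt)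
        (fun y _ => (hf y).differentiableAt.differentiableWithinAt)
      intro y hy
      rw [interior_Ici] at hy
      rw [(hf y).deriv]
      exact hf' y (le_of_lt hy)
    simpa [h0] using hmono Set.self_mem_Ici hx hx
  have sin_step : ∀ n : ℕ, (∀ x : ℝ, 0 ≤ x → 0 ≤ (-1) ^ (n + 1) * (cos x -
      ∑ k ∈ Finset.range (n + 1), (-1) ^ k * x ^ (2 * k) / (2 * k).factorial)) →
      ∀ x : ℝ, 0 ≤ x → 0 ≤ (-1) ^ (n + 1) * (sin x - ∑ k ∈ Finset.range (n + 1),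
      (-1) ^ k * x ^ (2 * k + 1) / (2 * k + 1).factorial) := by
    intro n h
    refine nonneg_of_deriv _ _ (fun x => ?_) (by simp) h
    refine ((hasDerivAt_sin x).sub (HasDerivAt.fun_sum fun k _ => ?_)).const_mul _
    have := ((hasDerivAt_pow (2 * k + 1) x).const_mul ((-1) ^ k)).div_const
      ((2 * k + 1).factorial : ℝ)
    refine this.congr_deriv ?_
    rw [Nat.factorial_succ, Nat.add_sub_cancel]
    have : ((2 * k).factorial : ℝ) ≠ 0 := by positivity
    push_cast
    field_simp
  induction n with
  | zero =>
    intro x hx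
    refine ⟨?_, sin_step 0 (fun x _ => ?_) x hx⟩
    · simpa using cos_le_one x
    · simpa using cos_le_one x
  | succ n ih =>
    have hcos : ∀ x : ℝ, 0 ≤ x → 0 ≤ (-1) ^ (n + 1 + 1) * (cos x -
        ∑ k ∈ Finset.range (n + 1 + 1), (-1) ^ k * x ^ (2 * k) / (2 * k).factorial) := by
      refine nonneg_of_deriv _ _ (fun x => ?_) (by simp [Finset.sum_range_succ'])
        (fun x hx => (ih x hx).2)
      have hs : HasDerivAt (fun x : ℝ => ∑ k ∈ Finset.range (n + 1 + 1),
          (-1) ^ k * x ^ (2 * k) / ((2 * k).factorial : ℝ))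
          (-∑ k ∈ Finset.range (n + 1), (-1) ^ k * x ^ (2 * k + 1) / (2 * k + 1).factorial) x := by
        simp only [Finset.sum_range_succ' _ (n + 1), mul_zero, pow_zero]
        rw [← Finset.sum_neg_distrib]
        refine (HasDerivAt.fun_sum (A := fun k (x : ℝ) => (-1) ^ (k + 1) * x ^ (2 * (k + 1)) /
          ((2 * (k + 1)).factorial : ℝ)) fun k _ => ?_).add_const _
        have := ((hasDerivAt_pow (2 * (k + 1)) x).const_mul ((-1) ^ (k + 1))).div_const
          ((2 * (k + 1)).factorial : ℝ)
        refine this.congr_deriv ?_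
        have h2 : 2 * (k + 1) = 2 * k + 1 + 1 := by ring
        rw [h2, Nat.factorial_succ (2 * k + 1), Nat.add_sub_cancel]
        have : ((2 * k + 1).factorial : ℝ) ≠ 0 := by positivity
        push_cast
        have h3 : (2 * (k : ℝ) + 1 + 1) ≠ 0 := by positivity
        field_simp
        ring
      refine (((hasDerivAt_cos x).sub hs).const_mul ((-1 : ℝ) ^ (n + 1 + 1))).congr_deriv ?_
      ring
    exact fun x hx => ⟨hcos x hx, sin_step (n + 1) hcos x hx⟩

/-- The Bessel function `J₀`. -/
noncomputable def besselJ0 (t : ℝ) : ℝ := π⁻¹ * ∫ θ in 0..π, cos (t * sin θ)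

/-- The Bessel function `J₁`. -/
noncomputable def besselJ1 (t : ℝ) : ℝ := π⁻¹ * ∫ θ in 0..π, sin θ * sin (t * sin θ)

/-- The cosine bounds at `t sin θ ≥ 0` are integrated in `θ`; the product is the Wallis mean of
`sin^(2k)` over `[0, π]`. -/
theorem besselJ0_taylor_alternating (n : ℕ) {t : ℝ} (ht : 0 ≤ t) :
    0 ≤ (-1) ^ (n + 1) * (besselJ0 t - ∑ k ∈ Finset.range (n + 1),
      (-1) ^ k * t ^ (2 * k) / (2 * k).factorial *
        ∏ i ∈ Finset.range k, (2 * (i : ℝ) + 1) / (2 * i + 2)) := by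
  have key : (-1) ^ (n + 1) * (besselJ0 t - ∑ k ∈ Finset.range (n + 1),
      (-1) ^ k * t ^ (2 * k) / (2 * k).factorial *
        ∏ i ∈ Finset.range k, (2 * (i : ℝ) + 1) / (2 * i + 2)) =
      π⁻¹ * ∫ θ in 0..π, (-1) ^ (n + 1) * (cos (t * sin θ) - ∑ k ∈ Finset.range (n + 1),
      (-1) ^ k * (t * sin θ) ^ (2 * k) / (2 * k).factorial) := by
    rw [intervalIntegral.integral_const_mul, intervalIntegral.integral_sub
      (Continuous.intervalIntegrable (by fun_prop) _ _)
      (Continuous.intervalIntegrable (by fun_prop) _ _),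
      intervalIntegral.integral_finsetSum
        (fun k _ => Continuous.intervalIntegrable (by fun_prop) _ _)]
    have : ∀ k : ℕ, ∫ θ in 0..π, (-1) ^ k * (t * sin θ) ^ (2 * k) / ((2 * k).factorial : ℝ) =
        π * ((-1) ^ k * t ^ (2 * k) / (2 * k).factorial *
        ∏ i ∈ Finset.range k, (2 * (i : ℝ) + 1) / (2 * i + 2)) := by
      intro k
      rw [show (fun θ => (-1) ^ k * (t * sin θ) ^ (2 * k) / ((2 * k).factorial : ℝ)) =
        fun θ => ((-1) ^ k * t ^ (2 * k) / (2 * k).factorial) * sin θ ^ (2 * k) by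
          funext θ; rw [mul_pow]; ring, intervalIntegral.integral_const_mul, integral_sin_pow_even]
      ring
    simp only [this, ← Finset.mul_sum, besselJ0]
    have := pi_ne_zero
    field_simp
  rw [key]
  refine mul_nonneg (by positivity) (intervalIntegral.integral_nonneg pi_nonneg fun θ hθ => ?_)
  exact (cos_sin_taylor_alternating n _ (mul_nonneg ht (sin_nonneg_of_mem_Icc hθ))).1

theorem besselJ1_taylor_alternating (n : ℕ) {t : ℝ} (ht : 0 ≤ t) :
    0 ≤ (-1) ^ (n + 1) * (besselJ1 t - ∑ k ∈ Finset.range (n + 1),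
      (-1) ^ k * t ^ (2 * k + 1) / (2 * k + 1).factorial *
        ∏ i ∈ Finset.range (k + 1), (2 * (i : ℝ) + 1) / (2 * i + 2)) := by
  have key : (-1) ^ (n + 1) * (besselJ1 t - ∑ k ∈ Finset.range (n + 1),
      (-1) ^ k * t ^ (2 * k + 1) / (2 * k + 1).factorial *
        ∏ i ∈ Finset.range (k + 1), (2 * (i : ℝ) + 1) / (2 * i + 2)) =
      π⁻¹ * ∫ θ in 0..π, sin θ * ((-1) ^ (n + 1) * (sin (t * sin θ) - ∑ k ∈ Finset.range (n + 1),
      (-1) ^ k * (t * sin θ) ^ (2 * k + 1) / (2 * k + 1).factorial)) := by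
    simp only [mul_left_comm (sin _) ((-1 : ℝ) ^ (n + 1)), mul_sub, Finset.mul_sum]
    rw [intervalIntegral.integral_sub
      (Continuous.intervalIntegrable (by fun_prop) _ _)
      (Continuous.intervalIntegrable (by fun_prop) _ _),
      intervalIntegral.integral_finsetSum
        (fun k _ => Continuous.intervalIntegrable (by fun_prop) _ _),
      intervalIntegral.integral_const_mul]
    have : ∀ k : ℕ, ∫ θ in 0..π, (-1) ^ (n + 1) * (sin θ *
        ((-1) ^ k * (t * sin θ) ^ (2 * k + 1) / ((2 * k + 1).factorial : ℝ))) =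
        π * ((-1) ^ (n + 1) * ((-1) ^ k * t ^ (2 * k + 1) / (2 * k + 1).factorial *
        ∏ i ∈ Finset.range (k + 1), (2 * (i : ℝ) + 1) / (2 * i + 2))) := by
      intro k
      rw [show (fun θ => (-1) ^ (n + 1) * (sin θ *
          ((-1) ^ k * (t * sin θ) ^ (2 * k + 1) / ((2 * k + 1).factorial : ℝ)))) =
        fun θ => ((-1) ^ (n + 1) * ((-1) ^ k * t ^ (2 * k + 1) / (2 * k + 1).factorial)) *
          sin θ ^ (2 * (k + 1)) by
          funext θ; rw [mul_pow]; ring, intervalIntegral.integral_const_mul, integral_sin_pow_even]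
      ring
    simp only [this, ← Finset.mul_sum, besselJ1]
    generalize (∫ θ in 0..π, sin θ * sin (t * sin θ)) = I
    have := pi_ne_zero
    field_simp
  rw [key]
  refine mul_nonneg (by positivity) (intervalIntegral.integral_nonneg pi_nonneg fun θ hθ => ?_)
  have hs := sin_nonneg_of_mem_Icc hθ
  exact mul_nonneg hs (cos_sin_taylor_alternating n _ (mul_nonneg ht hs)).2

theorem continuous_besselJ0 : Continuous besselJ0 := by
  unfold besselJ0
  exact continuous_const.mul
    (intervalIntegral.continuous_parametric_intervalIntegral_of_continuous' (by fun_prop) _ _)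

theorem hasDerivAt_besselJ0 (t : ℝ) : HasDerivAt besselJ0 (-besselJ1 t) t := by
  have h := (intervalIntegral.hasDerivAt_integral_of_dominated_loc_of_deriv_le
    (μ := volume) (a := 0) (b := π) (F := fun t θ => cos (t * sin θ))
    (F' := fun t θ => -sin (t * sin θ) * sin θ) (x₀ := t) (s := Set.univ) (bound := fun _ => 1)
    Filter.univ_mem
    (Filter.Eventually.of_forall fun x => Continuous.aestronglyMeasurable (by fun_prop))
    (Continuous.intervalIntegrable (by fun_prop) _ _)
    (Continuous.aestronglyMeasurable (by fun_prop))
    (Filter.Eventually.of_forall fun θ _ x _ => by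
      rw [norm_mul, norm_neg]
      exact mul_le_one₀ (abs_sin_le_one _) (norm_nonneg _) (abs_sin_le_one _))
    (by simp)
    (Filter.Eventually.of_forall fun θ _ x _ => by
      simpa using ((hasDerivAt_id x).mul_const (sin θ)).cos)).2.const_mul π⁻¹
  refine h.congr_deriv ?_
  rw [besselJ1, ← mul_neg, ← intervalIntegral.integral_neg]
  congr 2
  funext θ
  ring

/-- Differentiation under the integral gives the mean of `sin² θ cos(t sin θ)`. Writing `sin² = 1 -
cos²` and integrating the `cos²` part by parts yields `J₁(t)/t`. -/
theorem hasDerivAt_besselJ1 {t : ℝ} (ht : t ≠ 0) :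
    HasDerivAt besselJ1 (besselJ0 t - besselJ1 t / t) t := by
  have h := (intervalIntegral.hasDerivAt_integral_of_dominated_loc_of_deriv_le
    (μ := volume) (a := 0) (b := π) (F := fun t θ => sin θ * sin (t * sin θ))
    (F' := fun t θ => sin θ * (cos (t * sin θ) * sin θ)) (x₀ := t) (s := Set.univ)
    (bound := fun _ => 1)
    Filter.univ_mem
    (Filter.Eventually.of_forall fun x => Continuous.aestronglyMeasurable (by fun_prop))
    (Continuous.intervalIntegrable (by fun_prop) _ _)
    (Continuous.aestronglyMeasurable (by fun_prop))
    (Filter.Eventually.of_forall fun θ _ x _ => by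
      rw [norm_mul, norm_mul]
      exact mul_le_one₀ (abs_sin_le_one _) (by positivity)
        (mul_le_one₀ (abs_cos_le_one _) (norm_nonneg _) (abs_sin_le_one _)))
    (by simp)
    (Filter.Eventually.of_forall fun θ _ x _ => by
      simpa using (((hasDerivAt_id x).mul_const (sin θ)).sin).const_mul (sin θ))).2.const_mul π⁻¹
  refine h.congr_deriv ?_
  have parts := intervalIntegral.integral_mul_deriv_eq_deriv_mul (a := 0) (b := π)
    (u := cos) (v := fun θ => sin (t * sin θ)) (u' := fun θ => -sin θ)
    (v' := fun θ => cos (t * sin θ) * (t * cos θ))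
    (fun θ _ => hasDerivAt_cos θ) (fun θ _ => ((hasDerivAt_sin θ).const_mul t).sin)
    (Continuous.intervalIntegrable (by fun_prop) _ _)
    (Continuous.intervalIntegrable (by fun_prop) _ _)
  have e1 : ∫ θ in 0..π, cos θ * (cos (t * sin θ) * (t * cos θ)) =
      t * ((∫ θ in 0..π, cos (t * sin θ)) - ∫ θ in 0..π, sin θ * (cos (t * sin θ) * sin θ)) := by
    rw [← intervalIntegral.integral_sub (Continuous.intervalIntegrable (by fun_prop) _ _)
      (Continuous.intervalIntegrable (by fun_prop) _ _), ← intervalIntegral.integral_const_mul]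
    congr 1
    funext θ
    have := sin_sq_add_cos_sq θ
    linear_combination (t * cos (t * sin θ)) * this
  have e2 : ∫ θ in 0..π, -sin θ * sin (t * sin θ) = -∫ θ in 0..π, sin θ * sin (t * sin θ) := by
    rw [← intervalIntegral.integral_neg]
    congr 1
    funext θ
    ring
  rw [e1, e2] at parts
  simp only [sin_pi, mul_zero, sin_zero, sub_self, sub_neg_eq_add, zero_add] at parts
  simp only [besselJ0, besselJ1, ← parts]
  generalize (∫ θ in 0..π, cos (t * sin θ)) = I
  generalize (∫ θ in 0..π, sin θ * (cos (t * sin θ) * sin θ)) = I'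
  field_simp
  ring

theorem abs_besselJ0_le_one (t : ℝ) : |besselJ0 t| ≤ 1 := by
  have h := intervalIntegral.norm_integral_le_of_norm_le_const (a := 0) (b := π) (C := 1)
    (f := fun θ => cos (t * sin θ)) (fun θ _ => abs_cos_le_one _)
  rw [besselJ0, abs_mul, abs_of_pos (inv_pos.2 pi_pos)]
  rw [sub_zero, abs_of_pos pi_pos, one_mul, Real.norm_eq_abs] at h
  calc π⁻¹ * _ ≤ π⁻¹ * π := by gcongr
    _ = 1 := inv_mul_cancel₀ pi_ne_zero

theorem besselJ0_zero : besselJ0 0 = 1 := by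
  simp [besselJ0]

theorem besselJ0_ge {t : ℝ} (ht : 0 ≤ t) : 1 - t ^ 2 / 4 ≤ besselJ0 t := by
  have := besselJ0_taylor_alternating 1 ht
  norm_num [Finset.sum_range_succ, Finset.prod_range_succ, Nat.factorial] at this
  linarith

/-- With `x = t²/4 ≤ 1`, the bound `1 - x + x²/4` for `J₀` lies below the cubic Taylor estimate of
`exp(-x)`. The cutoff `37/20` is chosen so that `exp(-t²/4)` is still at least `21/50` there, the
bound for `|J₀|` beyond it. -/
theorem besselJ0_le_exp {t : ℝ} (ht : 0 ≤ t) (ht' : t ≤ 37 / 20) :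
    |besselJ0 t| ≤ exp (-t ^ 2 / 4) := by
  have h2 := besselJ0_taylor_alternating 2 ht
  have h1 := besselJ0_ge ht
  norm_num [Finset.sum_range_succ, Finset.prod_range_succ, Nat.factorial] at h2
  have hx : t ^ 2 / 4 ≤ 1 := by nlinarith
  have hx0 : 0 ≤ t ^ 2 / 4 := by positivity
  rw [abs_of_nonneg (by linarith)]
  have he := (abs_le.1 (exp_bound (x := -t ^ 2 / 4) (by
    rw [abs_le]; constructor <;> linarith) (n := 4) (by norm_num))).1
  norm_num [Finset.sum_range_succ, Nat.factorial] at he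
  rw [show |-t ^ 2 / 4| = t ^ 2 / 4 by rw [neg_div, abs_neg, abs_of_nonneg hx0]] at he
  nlinarith [pow_nonneg hx0 2, pow_nonneg hx0 3, mul_nonneg (pow_nonneg hx0 2) (sub_nonneg.2 hx)]

/-- The derivative is `-2 J₁(t)²/t`. Values at the single point 4 thereby control `J₀` on `[4, ∞)`.
-/
theorem antitoneOn_besselJ0_sq_add_besselJ1_sq :
    AntitoneOn (fun t => besselJ0 t ^ 2 + besselJ1 t ^ 2) (Set.Ici 4) := by
  have hd : ∀ t ∈ Set.Ici (4 : ℝ), HasDerivAt (fun t => besselJ0 t ^ 2 + besselJ1 t ^ 2)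
      (-2 * besselJ1 t ^ 2 / t) t := by
    intro t ht
    have ht0 : t ≠ 0 := by
      have : (4 : ℝ) ≤ t := ht
      linarith
    refine (((hasDerivAt_besselJ0 t).pow 2).add
      ((hasDerivAt_besselJ1 ht0).pow 2)).congr_deriv ?_
    field_simp
    ring
  apply antitoneOn_of_deriv_nonpos (convex_Ici 4)
    (fun y hy => (hd y hy).continuousAt.continuousWithinAt)
    (fun y hy => (hd y (interior_subset hy)).differentiableAt.differentiableWithinAt)
  intro y hy
  have hy' := interior_subset hy
  rw [(hd y hy').deriv]
  have : (4 : ℝ) ≤ y := hy'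
  exact div_nonpos_of_nonpos_of_nonneg (by nlinarith [sq_nonneg (besselJ1 y)]) (by linarith)

theorem abs_besselJ0_le_of_ge {t : ℝ} (ht : 37 / 20 ≤ t) : |besselJ0 t| ≤ 21 / 50 := by
  rcases le_total t 4 with h4 | h4
  · have ht0 : 0 ≤ t := by linarith
    have hu := besselJ0_taylor_alternating 4 ht0
    have hl := besselJ0_taylor_alternating 5 ht0
    norm_num [Finset.sum_range_succ, Finset.prod_range_succ, Nat.factorial] at hu hl
    obtain ⟨x, hx⟩ : ∃ x, x = t ^ 2 / 4 := ⟨_, rfl⟩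
    have e2 : t ^ 2 = 4 * x := by rw [hx]; ring
    have e4 : t ^ 4 = 16 * x ^ 2 := by rw [hx]; ring
    have e6 : t ^ 6 = 64 * x ^ 3 := by rw [hx]; ring
    have e8 : t ^ 8 = 256 * x ^ 4 := by rw [hx]; ring
    have e10 : t ^ 10 = 1024 * x ^ 5 := by rw [hx]; ring
    rw [e2, e4, e6, e8] at hu
    rw [e2, e4, e6, e8, e10] at hl
    have hx1 : 17 / 20 ≤ x := by nlinarith
    have hx2 : x ≤ 4 := by nlinarith
    rw [abs_le]
    constructor
    · have : -(21 / 50) ≤ 1 - x + x ^ 2 / 4 - x ^ 3 / 36 + x ^ 4 / 576 - x ^ 5 / 14400 := by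
        obtain ⟨y, hy⟩ : ∃ y, y = 4 - x := ⟨_, rfl⟩
        have hy0 : 0 ≤ y := by linarith
        obtain rfl : x = 4 - y := by linarith
        -- The polynomial attains its minimum near `y = 2/7`, just before `t = 4`.
        nlinarith [pow_nonneg hy0 3, pow_nonneg hy0 4, pow_nonneg hy0 5, sq_nonneg (y - 2 / 7)]
      linarith
    · have : 1 - x + x ^ 2 / 4 - x ^ 3 / 36 + x ^ 4 / 576 ≤ 21 / 50 := by
        obtain ⟨y, hy⟩ : ∃ y, y = 4 - x := ⟨_, rfl⟩
        have hy0 : 0 ≤ y := by linarith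
        have hy1 : 0 ≤ 63 / 20 - y := by linarith
        obtain rfl : x = 4 - y := by linarith
        have hyy := mul_nonneg hy0 hy1
        nlinarith [mul_nonneg hyy (sq_nonneg y), mul_nonneg hyy hy0]
      linarith
  · have h0u := besselJ0_taylor_alternating 6 (t := 4) (by norm_num)
    have h0l := besselJ0_taylor_alternating 5 (t := 4) (by norm_num)
    have h1u := besselJ1_taylor_alternating 4 (t := 4) (by norm_num)
    have h1l := besselJ1_taylor_alternating 5 (t := 4) (by norm_num)
    norm_num [Finset.sum_range_succ, Finset.prod_range_succ, Nat.factorial] at h0u h0l h1u h1l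
    have h := antitoneOn_besselJ0_sq_add_besselJ1_sq Set.self_mem_Ici h4 h4
    apply abs_le_of_sq_le_sq _ (by norm_num)
    simp only at h
    nlinarith [sq_nonneg (besselJ1 t)]

/-! ### Integrals over the half-line with weight `1/t²` -/

theorem integrableOn_min_const_div_sq (C D : ℝ) (hC : 0 ≤ C) (hD : 0 ≤ D) :
    IntegrableOn (fun t : ℝ => min C (D / t ^ 2)) (Set.Ioi 0) := by
  have hm : ∀ μ : Measure ℝ, AEStronglyMeasurable (fun t : ℝ => min C (D / t ^ 2)) μ := fun μ =>
    Measurable.aestronglyMeasurable (by fun_prop)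
  rw [← Set.Ioc_union_Ioi_eq_Ioi (zero_le_one (α := ℝ))]
  refine IntegrableOn.union ?_ ?_
  · refine Integrable.mono' (integrable_const C) (hm _) (Filter.Eventually.of_forall fun t => ?_)
    rw [norm_of_nonneg (le_min hC (by positivity))]
    exact min_le_left _ _
  · refine Integrable.mono' ((integrableOn_Ioi_rpow_of_lt (a := -2) (by norm_num)
      zero_lt_one).const_mul D) (hm _) ((ae_restrict_iff' measurableSet_Ioi).2
        (Filter.Eventually.of_forall fun t ht => ?_))
    rw [norm_of_nonneg (le_min hC (by positivity))]
    refine (min_le_right _ _).trans (le_of_eq ?_)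
    have ht0 : (0 : ℝ) < t := lt_trans zero_lt_one ht
    rw [rpow_neg ht0.le, div_eq_mul_inv]
    norm_cast

theorem div_sq_le_min {x t C D : ℝ} (ht : 0 < t) (h1 : |x| ≤ C * t ^ 2) (h2 : |x| ≤ D) :
    ‖x / t ^ 2‖ ≤ min C (D / t ^ 2) := by
  have : 0 < t ^ 2 := by positivity
  rw [norm_div, norm_eq_abs, norm_eq_abs, abs_of_pos this]
  refine le_min ?_ ?_
  · rwa [div_le_iff₀ this]
  · gcongr

theorem integrableOn_div_sq {f : ℝ → ℝ} (hf : Measurable f) {C D : ℝ} (hC : 0 ≤ C) (hD : 0 ≤ D)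
    (h1 : ∀ t, 0 < t → |f t| ≤ C * t ^ 2) (h2 : ∀ t, 0 < t → |f t| ≤ D) :
    IntegrableOn (fun t => f t / t ^ 2) (Set.Ioi 0) := by
  refine Integrable.mono' (integrableOn_min_const_div_sq C D hC hD)
    (Measurable.aestronglyMeasurable (by fun_prop)) ((ae_restrict_iff' measurableSet_Ioi).2
      (Filter.Eventually.of_forall fun t ht => ?_))
  exact div_sq_le_min ht (h1 t ht) (h2 t ht)

theorem abs_one_sub_exp_le {b t : ℝ} (hb : 0 ≤ b) :
    |1 - exp (-b * t ^ 2)| ≤ b * t ^ 2 ∧ |1 - exp (-b * t ^ 2)| ≤ 1 := by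
  have h0 : 0 ≤ b * t ^ 2 := by positivity
  have h1 := add_one_le_exp (-b * t ^ 2)
  have h2 : exp (-b * t ^ 2) ≤ 1 := exp_le_one_iff.2 (by linarith)
  have h3 := exp_pos (-b * t ^ 2)
  rw [abs_of_nonneg (by linarith)]
  constructor <;> linarith

theorem integrableOn_one_sub_exp_div_sq {b : ℝ} (hb : 0 ≤ b) :
    IntegrableOn (fun t : ℝ => (1 - exp (-b * t ^ 2)) / t ^ 2) (Set.Ioi 0) :=
  integrableOn_div_sq (by fun_prop) hb zero_le_one (fun _ _ => (abs_one_sub_exp_le hb).1)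
    (fun _ _ => (abs_one_sub_exp_le hb).2)

theorem integral_one_sub_exp_div_sq {b : ℝ} (hb : 0 < b) :
    ∫ t in Set.Ioi (0 : ℝ), (1 - exp (-b * t ^ 2)) / t ^ 2 = √(π * b) := by
  have hint : IntegrableOn (fun t : ℝ => (1 - exp (-b * t ^ 2)) / t ^ 2) (Set.Ioi 0) :=
    integrableOn_one_sub_exp_div_sq hb.le
  have hexp : IntegrableOn (fun t : ℝ => exp (-b * t ^ 2)) (Set.Ioi 0) :=
    (integrable_exp_neg_mul_sq hb).integrableOn
  -- Integration by parts: the function vanishes at both ends, so the integral sought equals `2b`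
  -- times a Gaussian integral.
  have key := integral_Ioi_of_hasDerivAt_of_tendsto (a := 0) (m := 0)
    (f := fun t : ℝ => -((1 - exp (-b * t ^ 2)) / t))
    (f' := fun t => (1 - exp (-b * t ^ 2)) / t ^ 2 - 2 * b * exp (-b * t ^ 2)) ?_ ?_ ?_ ?_
  · rw [integral_sub hint (hexp.const_mul _), integral_const_mul, integral_gaussian_Ioi] at key
    simp only [div_zero, neg_zero, sub_self] at key
    rw [sub_eq_zero.1 key, show π * b = b ^ 2 * (π / b) by field_simp,
      sqrt_mul (by positivity), sqrt_sq hb.le]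
    ring
  · refine ContinuousAt.continuousWithinAt ?_
    rw [ContinuousAt]
    simp only [div_zero, neg_zero]
    refine squeeze_zero_norm (a := fun t : ℝ => b * |t|) (fun t => ?_)
      (Continuous.tendsto' (by fun_prop) 0 0 (by simp))
    rcases eq_or_ne t 0 with rfl | ht
    · simp
    · rw [norm_neg, norm_div, norm_eq_abs, norm_eq_abs, div_le_iff₀ (abs_pos.2 ht), mul_assoc,
        abs_mul_abs_self, ← sq]
      exact (abs_one_sub_exp_le hb.le).1
  · intro t ht
    have ht0 : t ≠ 0 := ne_of_gt ht
    have h1 : HasDerivAt (fun t : ℝ => exp (-b * t ^ 2)) (exp (-b * t ^ 2) * (-b * (2 * t))) t := by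
      simpa using ((hasDerivAt_pow 2 t).const_mul (-b)).exp
    refine (((h1.const_sub 1).div (hasDerivAt_id t) ht0).neg).congr_deriv ?_
    simp only [id]
    field_simp
    ring
  · exact hint.sub (hexp.const_mul _)
  · refine squeeze_zero_norm' ?_ tendsto_inv_atTop_zero
    filter_upwards [Filter.eventually_gt_atTop 0] with t ht
    rw [norm_neg, norm_div, norm_eq_abs, norm_eq_abs, abs_of_pos ht, inv_eq_one_div]
    gcongr
    exact (abs_one_sub_exp_le hb.le).2

theorem abs_one_sub_cos_le (x : ℝ) : |1 - cos x| ≤ x ^ 2 / 2 ∧ |1 - cos x| ≤ 2 := by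
  have h1 := one_sub_sq_div_two_le_cos (x := x)
  have h2 := cos_le_one x
  have h3 := neg_one_le_cos x
  rw [abs_of_nonneg (by linarith)]
  constructor <;> linarith

theorem integral_exp_neg_mul_one_sub_cos (t : ℝ) :
    ∫ x in Set.Ioi (0 : ℝ), exp (-x) * (1 - cos (t * x)) = t ^ 2 / (1 + t ^ 2) := by
  have ha : (-1 + t * Complex.I : ℂ).re < 0 := by simp
  have h1 := integral_exp_mul_complex_Ioi ha 0
  have hi1 := integrableOn_exp_mul_complex_Ioi ha 0
  have h2 := congrArg Complex.re h1
  have hcos : ∀ x : ℝ, (Complex.exp ((-1 + t * Complex.I) * x)).re = exp (-x) * cos (t * x) := by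
    intro x
    rw [Complex.exp_re]
    simp
  rw [← RCLike.re_eq_complex_re, ← integral_re hi1] at h2
  simp only [RCLike.re_eq_complex_re, hcos] at h2
  have hi2 : IntegrableOn (fun x : ℝ => exp (-x) * cos (t * x)) (Set.Ioi 0) := by
    have := hi1.re
    simp only [RCLike.re_eq_complex_re, hcos] at this
    exact this
  have hi0 : IntegrableOn (fun x : ℝ => exp (-x)) (Set.Ioi 0) := integrableOn_exp_neg_Ioi 0
  simp only [mul_sub, mul_one]
  rw [integral_sub hi0 hi2, h2, integral_exp_neg_Ioi_zero]
  have : (1 + t ^ 2) ≠ 0 := by positivity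
  simp [Complex.div_re, Complex.normSq_apply]
  field_simp
  ring

/-- Fubini for `exp(-x) (1 - cos(tx)) / t²`. Integrating in `t` first gives the unknown integral
times `∫ x exp(-x) = 1`; integrating in `x` first gives `∫ 1/(1 + t²) = π/2`. -/
theorem integral_one_sub_cos_div_sq :
    ∫ t in Set.Ioi (0 : ℝ), (1 - cos t) / t ^ 2 = π / 2 := by
  have scale : ∀ x ∈ Set.Ioi (0 : ℝ), ∫ t in Set.Ioi (0 : ℝ), (1 - cos (t * x)) / t ^ 2 =
      x * ∫ t in Set.Ioi (0 : ℝ), (1 - cos t) / t ^ 2 := by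
    intro x hx
    have hx' : (0 : ℝ) < x := hx
    have := integral_comp_mul_right_Ioi (fun t : ℝ => (1 - cos t) / t ^ 2) 0 hx'
    rw [zero_mul, smul_eq_mul] at this
    rw [← mul_right_inj' (inv_ne_zero hx'.ne'), ← mul_assoc, inv_mul_cancel₀ hx'.ne', one_mul,
      ← mul_right_inj' (inv_ne_zero hx'.ne'), ← this, ← integral_const_mul, ← integral_const_mul]
    refine setIntegral_congr_fun measurableSet_Ioi fun t ht => ?_
    have ht' : t ≠ 0 := ne_of_gt ht
    field_simp
  have swap : ∫ x in Set.Ioi (0 : ℝ), ∫ t in Set.Ioi (0 : ℝ),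
      exp (-x) * (1 - cos (t * x)) / t ^ 2 = ∫ t in Set.Ioi (0 : ℝ), ∫ x in Set.Ioi (0 : ℝ),
      exp (-x) * (1 - cos (t * x)) / t ^ 2 := by
    apply integral_integral_swap
    have hb : IntegrableOn (fun x : ℝ => exp (-x) * (x ^ 2 + 2)) (Set.Ioi 0) := by
      have h3 := GammaIntegral_convergent (s := 3) (by norm_num)
      have h1 : IntegrableOn (fun x : ℝ => exp (-x)) (Set.Ioi 0) := integrableOn_exp_neg_Ioi 0
      refine (h3.add (h1.mul_const 2)).congr (Filter.Eventually.of_forall fun x => ?_)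
      norm_num [mul_add]
    refine Integrable.mono' (hb.mul_prod (integrableOn_min_const_div_sq 1 1 zero_le_one
      zero_le_one)) (Measurable.aestronglyMeasurable (by fun_prop)) ?_
    rw [Measure.prod_restrict]
    refine (ae_restrict_iff' (measurableSet_Ioi.prod measurableSet_Ioi)).2
      (Filter.Eventually.of_forall fun p hp => ?_)
    obtain ⟨hx, ht⟩ := hp
    simp only [Function.uncurry]
    have h := abs_one_sub_cos_le (p.2 * p.1)
    have := div_sq_le_min (x := 1 - cos (p.2 * p.1)) ht (C := p.1 ^ 2 + 2) (D := p.1 ^ 2 + 2)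
      (h.1.trans (by nlinarith [sq_nonneg p.2, mul_nonneg (sq_nonneg p.1) (sq_nonneg p.2)]))
      (h.2.trans (by nlinarith [sq_nonneg p.1]))
    rw [mul_div_assoc, norm_mul, norm_of_nonneg (exp_pos _).le, mul_assoc]
    refine mul_le_mul_of_nonneg_left (this.trans (le_of_eq ?_)) (exp_pos _).le
    rw [mul_min_of_nonneg _ _ (by positivity)]
    ring_nf
  have e1 : ∀ x : ℝ, x ∈ Set.Ioi (0 : ℝ) → ∫ t in Set.Ioi (0 : ℝ),
      exp (-x) * (1 - cos (t * x)) / t ^ 2 =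
      (exp (-x) * x) * ∫ t in Set.Ioi (0 : ℝ), (1 - cos t) / t ^ 2 := by
    intro x hx
    simp only [mul_div_assoc]
    rw [integral_const_mul, scale x hx, mul_assoc]
  have e2 : ∀ t : ℝ, t ∈ Set.Ioi (0 : ℝ) → ∫ x in Set.Ioi (0 : ℝ),
      exp (-x) * (1 - cos (t * x)) / t ^ 2 = (1 + t ^ 2)⁻¹ := by
    intro t ht
    have ht' : t ≠ 0 := ne_of_gt ht
    rw [integral_div, integral_exp_neg_mul_one_sub_cos]
    field_simp
  rw [setIntegral_congr_fun measurableSet_Ioi e1, setIntegral_congr_fun measurableSet_Ioi e2,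
    integral_mul_const, integral_Ioi_inv_one_add_sq] at swap
  have hG : ∫ x in Set.Ioi (0 : ℝ), exp (-x) * x = 1 := by
    have := Gamma_eq_integral (s := 2) (by norm_num)
    rw [Gamma_two] at this
    rw [this]
    norm_num
  rw [hG, one_mul] at swap
  simpa using swap

theorem integral_one_sub_cos_mul_div_sq {x : ℝ} (hx : 0 ≤ x) :
    ∫ t in Set.Ioi (0 : ℝ), (1 - cos (t * x)) / t ^ 2 = π / 2 * x := by
  rcases hx.eq_or_lt with rfl | hx'
  · simp
  have := integral_comp_mul_right_Ioi (fun t : ℝ => (1 - cos t) / t ^ 2) 0 hx'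
  rw [zero_mul, smul_eq_mul, integral_one_sub_cos_div_sq] at this
  have h2 : ∫ t in Set.Ioi (0 : ℝ), (1 - cos (t * x)) / t ^ 2 =
      x ^ 2 * ∫ t in Set.Ioi (0 : ℝ), (1 - cos (t * x)) / (t * x) ^ 2 := by
    rw [← integral_const_mul]
    refine setIntegral_congr_fun measurableSet_Ioi fun t ht => ?_
    have ht' : t ≠ 0 := ne_of_gt ht
    field_simp
  rw [h2, this]
  field_simp

theorem abs_one_sub_besselJ0_le {t : ℝ} (ht : 0 ≤ t) :
    |1 - besselJ0 t| ≤ t ^ 2 / 4 ∧ |1 - besselJ0 t| ≤ 2 := by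
  have h1 := besselJ0_ge ht
  have h2 := abs_le.1 (abs_besselJ0_le_one t)
  rw [abs_of_nonneg (by linarith)]
  constructor <;> linarith

/-- Average the cosine formula at `r sin θ` over `θ`. It represents a modulus as a mixture of values
of `J₀`, which are multiplicative over independent Steinhaus variables. -/
theorem integral_one_sub_besselJ0_mul_div_sq {r : ℝ} (hr : 0 ≤ r) :
    ∫ t in Set.Ioi (0 : ℝ), (1 - besselJ0 (t * r)) / t ^ 2 = r := by
  have e0 : ∀ t : ℝ, (1 - besselJ0 (t * r)) / t ^ 2 =
      π⁻¹ * ∫ θ in Set.Ioc 0 π, (1 - cos (t * (r * sin θ))) / t ^ 2 := by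
    intro t
    rw [integral_div, ← intervalIntegral.integral_of_le pi_nonneg, intervalIntegral.integral_sub
      (by simp) (Continuous.intervalIntegrable (by fun_prop) _ _), besselJ0]
    simp only [intervalIntegral.integral_const, sub_zero, smul_eq_mul, mul_one, mul_assoc]
    have := pi_ne_zero
    field_simp
  simp only [e0]
  rw [integral_const_mul, integral_integral_swap]
  · have e1 : ∀ θ ∈ Set.Ioc 0 π, ∫ t in Set.Ioi (0 : ℝ), (1 - cos (t * (r * sin θ))) / t ^ 2 =
        π / 2 * (r * sin θ) := fun θ hθ => integral_one_sub_cos_mul_div_sq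
          (mul_nonneg hr (sin_nonneg_of_mem_Icc ⟨hθ.1.le, hθ.2⟩))
    rw [setIntegral_congr_fun measurableSet_Ioc e1, ← intervalIntegral.integral_of_le pi_nonneg]
    simp only [intervalIntegral.integral_const_mul, integral_sin]
    have := pi_ne_zero
    field_simp
    norm_num [mul_comm]
  · refine Integrable.mono' ((integrable_const (μ := volume.restrict (Set.Ioc 0 π))
      (1 : ℝ)).mul_prod (integrableOn_min_const_div_sq (r ^ 2) 2 (by positivity)
      (by norm_num))).swap (Measurable.aestronglyMeasurable (by fun_prop)) ?_
    rw [Measure.prod_restrict]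
    refine (ae_restrict_iff' (measurableSet_Ioi.prod measurableSet_Ioc)).2
      (Filter.Eventually.of_forall fun p hp => ?_)
    have h := abs_one_sub_cos_le (p.1 * (r * sin p.2))
    simp only [Function.uncurry, Function.comp, Prod.swap, one_mul]
    refine div_sq_le_min hp.1 (h.1.trans ?_) h.2
    have := sin_sq_le_one p.2
    have h3 : 0 ≤ r ^ 2 * p.1 ^ 2 := by positivity
    nlinarith

/-! ### Steinhaus variables and the integral formula for `E|S|` -/

noncomputable instance : MeasurableSpace Circle := borel Circle

instance : BorelSpace Circle := ⟨rfl⟩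

instance : SecondCountableTopology Circle :=
  inferInstanceAs (SecondCountableTopology (Metric.sphere (0 : ℂ) 1))

/-- The law of a Steinhaus variable: the uniform probability measure on the unit circle. -/
noncomputable def steinhaus : Measure Circle :=
  ((ENNReal.ofReal (2 * π))⁻¹ • volume.restrict (Set.Ioc 0 (2 * π))).map Circle.exp

instance : IsProbabilityMeasure steinhaus := by
  have : IsProbabilityMeasure ((ENNReal.ofReal (2 * π))⁻¹ •
      volume.restrict (Set.Ioc 0 (2 * π))) := by
    refine ⟨?_⟩
    simp only [Measure.smul_apply, Measure.restrict_apply_univ, Real.volume_Ioc, sub_zero,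
      smul_eq_mul]
    exact ENNReal.inv_mul_cancel (by simp [pi_pos]) ENNReal.ofReal_ne_top
  exact Measure.isProbabilityMeasure_map Circle.exp.continuous.measurable.aemeasurable

theorem integral_steinhaus {E : Type*} [NormedAddCommGroup E] [NormedSpace ℝ E] {f : Circle → E}
    (hf : Continuous f) :
    ∫ z, f z ∂steinhaus = (2 * π)⁻¹ • ∫ θ in 0..(2 * π), f (Circle.exp θ) := by
  rw [steinhaus, integral_map Circle.exp.continuous.measurable.aemeasurable
    hf.aestronglyMeasurable, integral_smul_measure,
    intervalIntegral.integral_of_le (by positivity)]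
  simp [ENNReal.toReal_ofReal pi_nonneg]

theorem integrable_of_continuous_of_compact {X E : Type*} [TopologicalSpace X] [CompactSpace X]
    [MeasurableSpace X] [OpensMeasurableSpace X] [NormedAddCommGroup E] [SecondCountableTopology E]
    {μ : Measure X} [IsFiniteMeasure μ] {f : X → E} (hf : Continuous f) : Integrable f μ := by
  obtain ⟨C, hC⟩ := isCompact_univ.exists_bound_of_continuousOn hf.continuousOn
  borelize E
  exact Integrable.of_bound hf.measurable.aestronglyMeasurable C
    (Filter.Eventually.of_forall fun x => hC x trivial)

/-- Rotation removes the argument of `w`; the two half-periods contribute conjugate exponentials,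
which add up to a cosine. -/
theorem integral_exp_re_mul_steinhaus (w : ℂ) :
    ∫ z, Complex.exp (((w * (z : Circle)).re : ℂ) * Complex.I) ∂steinhaus = besselJ0 ‖w‖ := by
  set g : ℝ → ℂ := fun θ => Complex.exp (((‖w‖ * sin θ : ℝ) : ℂ) * Complex.I) with hg
  have hgc : Continuous g := by fun_prop
  have hper : Function.Periodic g (2 * π) := fun θ => by
    simp only [hg, sin_add_two_pi]
  rw [integral_steinhaus (by fun_prop)]
  have hw : ∀ θ : ℝ, Complex.exp (((w * (Circle.exp θ : ℂ)).re : ℂ) * Complex.I) =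
      g (θ + (w.arg + π / 2)) := by
    intro θ
    simp only [hg]
    congr 3
    rw [← add_assoc, sin_add_pi_div_two]
    nth_rewrite 1 [← Complex.norm_mul_exp_arg_mul_I w]
    rw [Circle.coe_exp, mul_assoc, ← Complex.exp_add, ← add_mul, ← Complex.ofReal_add,
      Complex.re_ofReal_mul, Complex.exp_ofReal_mul_I_re, add_comm]
  simp only [hw]
  rw [intervalIntegral.integral_comp_add_right, zero_add, add_comm (2 * π),
    hper.intervalIntegral_add_eq (w.arg + π / 2) 0, zero_add,
    ← intervalIntegral.integral_add_adjacent_intervals (b := π) (hgc.intervalIntegrable _ _)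
      (hgc.intervalIntegrable _ _)]
  have h2 : ∫ θ in π..(2 * π), g θ = ∫ θ in 0..π, g (θ + π) := by
    rw [intervalIntegral.integral_comp_add_right, zero_add, two_mul]
  rw [h2, ← intervalIntegral.integral_add (hgc.intervalIntegrable _ _)
    (Continuous.intervalIntegrable (by fun_prop) _ _)]
  have h3 : ∀ θ, g θ + g (θ + π) = ((2 * cos (‖w‖ * sin θ) : ℝ) : ℂ) := by
    intro θ
    simp only [hg, sin_add_pi, mul_neg]
    push_cast
    rw [Complex.two_cos]
  simp only [h3]
  rw [intervalIntegral.integral_ofReal, intervalIntegral.integral_const_mul, besselJ0]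
  have := pi_ne_zero
  rw [Complex.real_smul, ← Complex.ofReal_mul]
  congr 1
  field_simp

theorem integral_comp_mul_steinhaus {f : Circle → ℝ} (hf : Continuous f) (u : Circle) :
    ∫ z, f (u * z) ∂steinhaus = ∫ z, f z ∂steinhaus := by
  obtain ⟨φ, rfl⟩ := Circle.exp_surjective u
  rw [integral_steinhaus (by fun_prop), integral_steinhaus hf]
  have hper : Function.Periodic (fun θ => f (Circle.exp θ)) (2 * π) := fun θ => by
    simp only [Circle.exp_add, Circle.exp_two_pi, mul_one]
  have := hper.intervalIntegral_add_eq φ 0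
  rw [zero_add] at this
  rw [← this]
  congr 1
  have h2 := intervalIntegral.integral_comp_add_left (a := 0) (b := 2 * π)
    (fun θ => f (Circle.exp θ)) φ
  rw [add_zero] at h2
  rw [← h2]
  simp only [Circle.exp_add]

theorem integral_norm_add_steinhaus (w : Circle) :
    ∫ z : Circle, ‖(z : ℂ) + w‖ ∂steinhaus = 4 / π := by
  rw [← integral_comp_mul_steinhaus (by fun_prop) (-w), integral_steinhaus (by fun_prop)]
  have h : ∀ θ ∈ Set.uIcc 0 (2 * π), ‖((-w * Circle.exp θ : Circle) : ℂ) + w‖ =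
      2 * sin (θ / 2) := by
    intro θ hθ
    rw [Set.uIcc_of_le (by positivity)] at hθ
    have e : ((-w * Circle.exp θ : Circle) : ℂ) + w = -w * (Complex.exp (Complex.I * θ) - 1) := by
      rw [mul_comm Complex.I]
      push_cast
      ring
    rw [e, norm_mul, norm_neg, Circle.norm_coe, one_mul,
      Complex.norm_exp_I_mul_ofReal_sub_one, norm_of_nonneg]
    have : 0 ≤ sin (θ / 2) := sin_nonneg_of_nonneg_of_le_pi (by linarith [hθ.1])
      (by linarith [hθ.2])
    positivity
  rw [intervalIntegral.integral_congr h, intervalIntegral.integral_const_mul,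
    intervalIntegral.integral_comp_div (fun θ => sin θ) (by norm_num)]
  simp only [zero_div, integral_sin, cos_zero, smul_eq_mul]
  rw [mul_div_cancel_left₀ _ (by norm_num), cos_pi]
  field_simp
  norm_num

variable {ι : Type*} [Fintype ι]

/-- The joint law of independent Steinhaus variables. -/
noncomputable abbrev steinhausPi (ι : Type*) [Fintype ι] : Measure (ι → Circle) :=
  Measure.pi fun _ => steinhaus

/-- A linear combination of Steinhaus variables. -/
noncomputable def steinhausSum (c : ι → ℂ) (z : ι → Circle) : ℂ := ∑ k, c k * z k

@[fun_prop]
theorem continuous_steinhausSum (c : ι → ℂ) : Continuous (steinhausSum c) := by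
  unfold steinhausSum
  fun_prop

theorem norm_steinhausSum_le (c : ι → ℂ) (z : ι → Circle) : ‖steinhausSum c z‖ ≤ ∑ k, ‖c k‖ := by
  refine (norm_sum_le _ _).trans (le_of_eq ?_)
  simp only [norm_mul, Circle.norm_coe, mul_one]

/-- An auxiliary Steinhaus variable `ζ` writes `J₀(|S|)` as the mean of `exp(i Re(Sζ))`. Averaging
over `z` first, independence factors the exponential, and the result no longer depends on `ζ`. -/
theorem integral_besselJ0_norm_steinhausSum (c : ι → ℂ) :
    ∫ z, besselJ0 ‖steinhausSum c z‖ ∂steinhausPi ι = ∏ k, besselJ0 ‖c k‖ := by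
  rw [← Complex.ofReal_inj, ← integral_complex_ofReal]
  simp only [← integral_exp_re_mul_steinhaus (steinhausSum c _)]
  rw [integral_integral_swap
    (integrable_of_continuous_of_compact (by unfold Function.uncurry; fun_prop))]
  have h : ∀ ζ : Circle, ∫ z, Complex.exp (((steinhausSum c z * ζ).re : ℂ) * Complex.I)
      ∂steinhausPi ι = ((∏ k, besselJ0 ‖c k‖ : ℝ) : ℂ) := by
    intro ζ
    have h1 : ∀ z : ι → Circle, Complex.exp (((steinhausSum c z * ζ).re : ℂ) * Complex.I) =
        ∏ k, Complex.exp (((c k * ζ * z k).re : ℂ) * Complex.I) := by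
      intro z
      rw [← Complex.exp_sum, ← Finset.sum_mul, steinhausSum, Finset.sum_mul, Complex.re_sum]
      push_cast
      simp only [mul_right_comm]
    simp only [h1]
    rw [integral_fintype_prod_eq_prod
      (fun k (z : Circle) => Complex.exp (((c k * ζ * z).re : ℂ) * Complex.I))]
    simp only [integral_exp_re_mul_steinhaus, norm_mul, Circle.norm_coe, mul_one]
    push_cast
    rfl
  simp only [h, integral_const]
  simp

theorem integral_norm_steinhausSum (c : ι → ℂ) :
    ∫ z, ‖steinhausSum c z‖ ∂steinhausPi ι =
      ∫ t in Set.Ioi (0 : ℝ), (1 - ∏ k, besselJ0 (t * ‖c k‖)) / t ^ 2 := by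
  have e1 : ∀ z, ‖steinhausSum c z‖ =
      ∫ t in Set.Ioi (0 : ℝ), (1 - besselJ0 (t * ‖steinhausSum c z‖)) / t ^ 2 := fun z =>
    (integral_one_sub_besselJ0_mul_div_sq (norm_nonneg _)).symm
  have hJ := continuous_besselJ0
  rw [integral_congr_ae (Filter.Eventually.of_forall e1), integral_integral_swap]
  · refine setIntegral_congr_fun measurableSet_Ioi fun t ht => ?_
    have ht0 : (0 : ℝ) < t := ht
    have hc : ∀ z, t * ‖steinhausSum c z‖ = ‖steinhausSum (fun k => t * c k) z‖ := by
      intro z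
      rw [steinhausSum, steinhausSum]
      simp only [mul_assoc]
      rw [← Finset.mul_sum, norm_mul, Complex.norm_real, norm_of_nonneg ht0.le]
    simp only [hc]
    rw [integral_div, integral_sub (integrable_const _)
      (integrable_of_continuous_of_compact (by fun_prop)), integral_besselJ0_norm_steinhausSum]
    simp [abs_of_pos ht0]
  · set R := ∑ k, ‖c k‖
    refine Integrable.mono' ((integrable_const (μ := steinhausPi ι) (1 : ℝ)).mul_prod
      (integrableOn_min_const_div_sq (R ^ 2) 2 (by positivity) (by norm_num)))
      (Measurable.aestronglyMeasurable ?_) ?_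
    · have hJm := hJ.measurable
      have hS := (continuous_steinhausSum c).measurable
      unfold Function.uncurry
      fun_prop
    · have : steinhausPi ι = (steinhausPi ι).restrict Set.univ := Measure.restrict_univ.symm
      rw [this, Measure.prod_restrict]
      refine (ae_restrict_iff' (MeasurableSet.univ.prod measurableSet_Ioi)).2
        (Filter.Eventually.of_forall fun p hp => ?_)
      have hp2 : 0 < p.2 := hp.2
      have h := abs_one_sub_besselJ0_le (t := p.2 * ‖steinhausSum c p.1‖) (by positivity)
      simp only [Function.uncurry, one_mul]
      refine div_sq_le_min hp2 (h.1.trans ?_) h.2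
      have h4 : ‖steinhausSum c p.1‖ ^ 2 ≤ R ^ 2 := by
        gcongr
        exact norm_steinhausSum_le c p.1
      nlinarith [mul_nonneg (sub_nonneg.2 h4) (sq_nonneg p.2), mul_nonneg (sq_nonneg R)
        (sq_nonneg p.2)]

theorem integral_steinhausPi_insertNth {n : ℕ} (i : Fin (n + 1)) {f : (Fin (n + 1) → Circle) → ℝ}
    (hf : Continuous f) :
    ∫ z, f z ∂steinhausPi (Fin (n + 1)) =
      ∫ z, ∫ ζ, f (i.insertNth ζ z) ∂steinhaus ∂steinhausPi (Fin n) := by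
  have hins : Continuous fun p : Circle × (Fin n → Circle) =>
      (i.insertNth p.1 p.2 : Fin (n + 1) → Circle) := by fun_prop
  rw [← ((measurePreserving_piFinSuccAbove (fun _ => steinhaus) i).symm).integral_comp',
    integral_prod_symm]
  · rfl
  · exact integrable_of_continuous_of_compact (hf.comp hins)

/-- This is `E|z_1 + z_2| = 4/π` read through the integral formula: an exact value for the case `q =
1` of the one-variable inequality. -/
theorem integral_one_sub_besselJ0_sq_div_sq :
    ∫ t in Set.Ioi (0 : ℝ), (1 - besselJ0 t ^ 2) / t ^ 2 = 4 / π := by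
  have h := integral_norm_steinhausSum (fun _ : Fin 2 => (1 : ℂ))
  rw [integral_steinhausPi_insertNth 0 (by fun_prop)] at h
  simp only [steinhausSum, Fin.sum_univ_two, one_mul, Fin.insertNth_zero', Fin.cons_zero,
    Fin.cons_one, integral_norm_add_steinhaus] at h
  simpa using h.symm

/-! ### The one-variable integral inequality -/

theorem mul_sub_le_rpow_sub_rpow {X Y p : ℝ} (hY : 0 ≤ Y) (hYX : Y ≤ X) (hX : X ≤ 1)
    (hp0 : 0 < p) (hp : p ≤ 1) : p * (X - Y) ≤ X ^ p - Y ^ p := by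
  rcases (hY.trans hYX).eq_or_lt with rfl | hX0
  · obtain rfl : Y = 0 := le_antisymm hYX hY
    simp
  have h1 := rpow_one_add_le_one_add_mul_self (s := Y / X - 1)
    (by have : 0 ≤ Y / X := by positivity
        linarith) hp0.le hp
  rw [add_sub_cancel, div_rpow hY hX0.le, div_le_iff₀ (by positivity)] at h1
  have h2 : 1 ≤ X ^ p / X := by
    rw [one_le_div hX0]
    simpa using rpow_le_rpow_of_exponent_ge hX0 hX hp
  have h3 : (1 + p * (Y / X - 1)) * X ^ p = X ^ p - p * (X - Y) * (X ^ p / X) := by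
    field_simp
    ring
  have h4 : 0 ≤ p * (X - Y) := mul_nonneg hp0.le (by linarith)
  nlinarith

/-- Indeed `X^p - Y^p ≥ X^(p-1) (X - Y)`. This for `p ≥ 1`, and the preceding Bernoulli estimate for
`p ≤ 1`, compare a general exponent with the exponent 1, where the integrals are known. -/
theorem rpow_mul_sub_le_rpow_sub_rpow {X Y m p : ℝ} (hm : 0 ≤ m) (hmX : m ≤ X) (hY : 0 ≤ Y)
    (hYX : Y ≤ X) (hp : 1 ≤ p) : m ^ (p - 1) * (X - Y) ≤ X ^ p - Y ^ p := by
  have split : ∀ x : ℝ, 0 ≤ x → x ^ p = x ^ (p - 1) * x := by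
    intro x hx
    have := rpow_add_of_nonneg hx (sub_nonneg.2 hp) zero_le_one
    rwa [sub_add_cancel, rpow_one] at this
  rw [split X (hY.trans hYX), split Y hY]
  have h1 : Y ^ (p - 1) ≤ X ^ (p - 1) := rpow_le_rpow hY hYX (by linarith)
  have h2 : m ^ (p - 1) ≤ X ^ (p - 1) := rpow_le_rpow hm hmX (by linarith)
  nlinarith [mul_le_mul_of_nonneg_right h1 hY, mul_le_mul_of_nonneg_right h2 (sub_nonneg.2 hYX)]

theorem le_exp_neg_half_sq {u : ℝ} (hu : 0 ≤ u) (hu' : u ≤ 37 / 20) :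
    (21 / 50 : ℝ) ^ 2 ≤ exp (-(1 / 2) * u ^ 2) := by
  have h1 : exp (-(1 / 2) * u ^ 2) = exp (-u ^ 2 / 4) ^ 2 := by
    rw [← exp_nat_mul]
    congr 1
    push_cast
    ring
  rw [h1]
  gcongr
  have h2 : exp (-1 + 0.14) ≤ exp (-u ^ 2 / 4) := exp_le_exp.2 (by nlinarith)
  refine le_trans ?_ h2
  rw [exp_add, exp_neg]
  have h3 := quadratic_le_exp_of_nonneg (x := 0.14) (by norm_num)
  have h4 := exp_one_lt_d9
  have h5 : (0.367 : ℝ) ≤ (exp 1)⁻¹ := by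
    rw [le_inv_comm₀ (by norm_num) (exp_pos 1)]
    exact h4.le.trans (by norm_num)
  have h6 : (0 : ℝ) ≤ (exp 1)⁻¹ := by positivity
  nlinarith

theorem besselJ0_sq_le_exp {u : ℝ} (hu : 0 ≤ u) (hu' : u ≤ 37 / 20) :
    besselJ0 u ^ 2 ≤ exp (-(1 / 2) * u ^ 2) := by
  have h1 : exp (-(1 / 2) * u ^ 2) = exp (-u ^ 2 / 4) ^ 2 := by
    rw [← exp_nat_mul]
    congr 1
    push_cast
    ring
  rw [h1, ← sq_abs]
  gcongr
  exact besselJ0_le_exp hu hu'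

theorem besselJ0_sq_le {u : ℝ} (hu : 37 / 20 ≤ u) : besselJ0 u ^ 2 ≤ (21 / 50) ^ 2 := by
  rw [← sq_abs]
  gcongr
  exact abs_besselJ0_le_of_ge hu

theorem besselJ0_sq_le_one (u : ℝ) : besselJ0 u ^ 2 ≤ 1 := by
  rw [← sq_abs]
  exact pow_le_one₀ (abs_nonneg _) (abs_besselJ0_le_one u)

theorem abs_one_sub_besselJ0_sq_rpow_le {u q : ℝ} (hu : 0 ≤ u) (hq : 0 < q) :
    |1 - (besselJ0 u ^ 2) ^ q| ≤ (q + 1) * u ^ 2 ∧ |1 - (besselJ0 u ^ 2) ^ q| ≤ 1 := by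
  have hY0 : 0 ≤ besselJ0 u ^ 2 := sq_nonneg _
  have hY1 := besselJ0_sq_le_one u
  have hp0 : 0 ≤ (besselJ0 u ^ 2) ^ q := rpow_nonneg hY0 q
  have hp1 : (besselJ0 u ^ 2) ^ q ≤ 1 := rpow_le_one hY0 hY1 hq.le
  have hY2 : 1 - u ^ 2 / 2 ≤ besselJ0 u ^ 2 := by
    have := besselJ0_ge hu
    nlinarith [sq_nonneg (besselJ0 u - 1)]
  rw [abs_of_nonneg (by linarith)]
  refine ⟨?_, by linarith⟩
  rcases le_total q 1 with h | h
  · have : besselJ0 u ^ 2 ≤ (besselJ0 u ^ 2) ^ q := by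
      rcases hY0.eq_or_lt with h0 | h0
      · rw [← h0]
        positivity
      · simpa using rpow_le_rpow_of_exponent_ge h0 hY1 h
    nlinarith [sq_nonneg u, mul_nonneg hq.le (sq_nonneg u)]
  · have := one_add_mul_self_le_rpow_one_add (s := besselJ0 u ^ 2 - 1) (by linarith) h
    rw [add_sub_cancel] at this
    nlinarith [sq_nonneg u, mul_nonneg hq.le (sq_nonneg u)]

theorem integrableOn_one_sub_besselJ0_sq_rpow_div_sq {q : ℝ} (hq : 0 < q) :
    IntegrableOn (fun u => (1 - (besselJ0 u ^ 2) ^ q) / u ^ 2) (Set.Ioi 0) := by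
  have hJ := continuous_besselJ0.measurable
  exact integrableOn_div_sq (by fun_prop) (by positivity) zero_le_one
    (fun u hu => (abs_one_sub_besselJ0_sq_rpow_le hu.le hq).1)
    (fun u hu => (abs_one_sub_besselJ0_sq_rpow_le hu.le hq).2)

/-- The derivative of `-exp(-u²/2) / (u(u² + 2))` dominates the integrand as soon as `u² ≥ 2`. The
constant has to stay below the gap at `q = 1`, which is at least 0.0198. -/
theorem integral_exp_neg_half_sq_div_sq_tail :
    IntegrableOn (fun u : ℝ => exp (-(1 / 2) * u ^ 2) / u ^ 2) (Set.Ioi (37 / 20)) ∧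
    ∫ u in Set.Ioi (37 / 20 : ℝ), exp (-(1 / 2) * u ^ 2) / u ^ 2 ≤ 0.019 := by
  set g : ℝ → ℝ := fun u => -(exp (-(1 / 2) * u ^ 2) / (u * (u ^ 2 + 2))) with hg
  set g' : ℝ → ℝ := fun u => exp (-(1 / 2) * u ^ 2) / u ^ 2 *
    ((u ^ 4 + 5 * u ^ 2 + 2) / (u ^ 2 + 2) ^ 2) with hg'
  have hderiv : ∀ u ∈ Set.Ici (37 / 20 : ℝ), HasDerivAt g (g' u) u := by
    intro u hu
    have hu0 : u ≠ 0 := by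
      have : (37 / 20 : ℝ) ≤ u := hu
      linarith
    have h1 : HasDerivAt (fun t : ℝ => exp (-(1 / 2) * t ^ 2))
        (exp (-(1 / 2) * u ^ 2) * (-(1 / 2) * (2 * u))) u := by
      refine (((hasDerivAt_pow 2 u).const_mul (-(1 / 2))).exp).congr_deriv ?_
      norm_num
    have h2 : HasDerivAt (fun t : ℝ => t * (t ^ 2 + 2)) (1 * (u ^ 2 + 2) + u * (2 * u)) u := by
      refine ((hasDerivAt_id' u).mul ((hasDerivAt_pow 2 u).add_const 2)).congr_deriv ?_
      norm_num
    have h3 : u ^ 2 + 2 ≠ 0 := by positivity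
    refine ((h1.div h2 (mul_ne_zero hu0 h3)).neg).congr_deriv ?_
    simp only [hg']
    field_simp
    ring
  have hpos : ∀ u ∈ Set.Ioi (37 / 20 : ℝ), 0 ≤ g' u := fun u _ => by positivity
  have hlim : Filter.Tendsto g Filter.atTop (nhds 0) := by
    refine squeeze_zero_norm' ?_ tendsto_inv_atTop_zero
    filter_upwards [Filter.eventually_ge_atTop 1] with u hu
    have hu0 : 0 < u := by linarith
    rw [norm_neg, norm_of_nonneg (by positivity), inv_eq_one_div]
    gcongr
    · exact exp_le_one_iff.2 (by nlinarith)
    · nlinarith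
  have hle : ∀ u ∈ Set.Ioi (37 / 20 : ℝ), exp (-(1 / 2) * u ^ 2) / u ^ 2 ≤ g' u := by
    intro u hu
    have hu' : (37 / 20 : ℝ) < u := hu
    simp only [hg']
    refine le_mul_of_one_le_right (by positivity) ?_
    rw [one_le_div (by positivity)]
    nlinarith
  have hint := integrableOn_Ioi_deriv_of_nonneg' hderiv hpos hlim
  have hval := integral_Ioi_of_hasDerivAt_of_nonneg' hderiv hpos hlim
  have hint' : IntegrableOn (fun u : ℝ => exp (-(1 / 2) * u ^ 2) / u ^ 2)
      (Set.Ioi (37 / 20)) := by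
    refine Integrable.mono' hint (Measurable.aestronglyMeasurable (by fun_prop))
      ((ae_restrict_iff' measurableSet_Ioi).2 (Filter.Eventually.of_forall fun u hu => ?_))
    rw [norm_of_nonneg (by positivity)]
    exact hle u hu
  refine ⟨hint', (setIntegral_mono_on hint' hint measurableSet_Ioi hle).trans ?_⟩
  rw [hval]
  have h1 : exp (-(1 / 2) * (37 / 20 : ℝ) ^ 2) ≤ 0.19 := by
    rw [show -(1 / 2) * (37 / 20 : ℝ) ^ 2 = -(2 * (0.855625)) by norm_num, exp_neg,
      two_mul, exp_add]
    have h2 : exp 1 * (1 - 0.144375) ≤ exp 0.855625 := by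
      rw [show (0.855625 : ℝ) = 1 + (-0.144375) by norm_num, exp_add]
      have := add_one_le_exp (-0.144375 : ℝ)
      gcongr
      linarith
    have h3 := exp_one_gt_d9
    have h4 : 2.32 ≤ exp 0.855625 := by nlinarith
    rw [inv_le_comm₀ (by positivity) (by norm_num)]
    nlinarith
  simp only [hg]
  norm_num at h1 ⊢
  linarith

theorem four_div_pi_sub_sqrt_lower_bound : 0.0198 ≤ 4 / π - √(π * (1 / 2)) := by
  have h1 := pi_gt_d6
  have h2 := pi_lt_d6
  have h3 : √(π * (1 / 2)) ≤ 1.25332 := by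
    rw [sqrt_le_left (by norm_num)]
    linarith
  have h4 : 1.27323 ≤ 4 / π := by
    rw [le_div_iff₀ pi_pos]
    linarith
  linarith

/-- The key one-variable inequality: `∫ (1 - |J₀(u)|^(2q)) / u²` is at least its Gaussian
analogue. -/
theorem sqrt_le_integral_one_sub_besselJ0_sq_rpow {q : ℝ} (hq : 0.95 ≤ q) :
    √(π * (q / 2)) ≤ ∫ u in Set.Ioi (0 : ℝ), (1 - (besselJ0 u ^ 2) ^ q) / u ^ 2 := by
  have hq0 : 0 < q := by linarith
  have hT := four_div_pi_sub_sqrt_lower_bound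
  have hA : IntegrableOn (fun u : ℝ => (1 - exp (-(q / 2) * u ^ 2)) / u ^ 2) (Set.Ioi 0) :=
    integrableOn_one_sub_exp_div_sq (by positivity)
  have hA1 : IntegrableOn (fun u : ℝ => (1 - exp (-(1 / 2) * u ^ 2)) / u ^ 2) (Set.Ioi 0) :=
    integrableOn_one_sub_exp_div_sq (by positivity)
  have hB := integrableOn_one_sub_besselJ0_sq_rpow_div_sq hq0
  have hB1 : IntegrableOn (fun u => (1 - besselJ0 u ^ 2) / u ^ 2) (Set.Ioi 0) := by
    simpa using integrableOn_one_sub_besselJ0_sq_rpow_div_sq one_pos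
  have vA := integral_one_sub_exp_div_sq (b := q / 2) (by positivity)
  have vA1 := integral_one_sub_exp_div_sq (b := 1 / 2) (by positivity)
  have hexp : ∀ u : ℝ, exp (-(q / 2) * u ^ 2) = exp (-(1 / 2) * u ^ 2) ^ q := by
    intro u
    rw [← exp_mul]
    ring_nf
  -- Put `X = exp(-u²/2)` and `Y = J₀(u)²`. The claim is that `(X^q - Y^q)/u²` has nonnegative
  -- integral. It suffices to minorize `X^q - Y^q` by `m (X - Y)`, up to an error `k u²` beyond
  -- `37/20` whose cost `∫ k` is at most `m` times the explicit gap at `q = 1`.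
  have main : ∀ (m : ℝ) (k : ℝ → ℝ), IntegrableOn k (Set.Ioi (37 / 20)) →
      0 ≤ m * (4 / π - √(π * (1 / 2))) - ∫ u in Set.Ioi (37 / 20 : ℝ), k u →
      (∀ u : ℝ, 0 < u → m * (exp (-(1 / 2) * u ^ 2) - besselJ0 u ^ 2) -
        (Set.Ioi (37 / 20)).indicator (fun u => k u * u ^ 2) u ≤
        exp (-(1 / 2) * u ^ 2) ^ q - (besselJ0 u ^ 2) ^ q) →
      √(π * (q / 2)) ≤ ∫ u in Set.Ioi (0 : ℝ), (1 - (besselJ0 u ^ 2) ^ q) / u ^ 2 := by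
    intro m k hk hm hpt
    have hk' : IntegrableOn ((Set.Ioi (37 / 20 : ℝ)).indicator k) (Set.Ioi 0) :=
      ((integrable_indicator_iff measurableSet_Ioi).2 hk).integrableOn
    have vk : ∫ u in Set.Ioi (0 : ℝ), (Set.Ioi (37 / 20 : ℝ)).indicator k u =
        ∫ u in Set.Ioi (37 / 20 : ℝ), k u := by
      rw [setIntegral_indicator measurableSet_Ioi, Set.Ioi_inter_Ioi]
      norm_num
    have hle := setIntegral_mono_on ((hA.add ((hB1.sub hA1).const_mul m)).sub hk') hB
      measurableSet_Ioi (fun u hu => ?_)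
    · rw [integral_sub' (hA.add ((hB1.sub hA1).const_mul m)) hk',
        integral_add' hA ((hB1.sub hA1).const_mul m), integral_const_mul, integral_sub' hB1 hA1,
        vA, vA1, vk, integral_one_sub_besselJ0_sq_div_sq] at hle
      linarith
    · have hu0 : (0 : ℝ) < u := hu
      have hu2 : (0 : ℝ) < u ^ 2 := by positivity
      have h := hpt u hu0
      have hind : (Set.Ioi (37 / 20 : ℝ)).indicator k u =
          (Set.Ioi (37 / 20 : ℝ)).indicator (fun u => k u * u ^ 2) u / u ^ 2 := by
        by_cases hmem : u ∈ Set.Ioi (37 / 20 : ℝ)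
        · simp only [Set.indicator_of_mem hmem]
          field_simp
        · simp only [Set.indicator_of_notMem hmem, zero_div]
      simp only [Pi.sub_apply, Pi.add_apply, hind, hexp]
      rw [← sub_div, ← mul_div_assoc, ← add_div, ← sub_div]
      refine (div_le_div_iff_of_pos_right hu2).2 ?_
      linarith
  rcases le_total 1 q with h1 | h1
  -- Here `m = D^(q-1)` with `D = (21/50)²`. Up to `37/20` one has `Y ≤ X` and `D ≤ X`. Beyond, `Y ≤
  -- D` gives `Y^q ≤ mY`, so the error is `mX`, integrated by the Gaussian tail bound.
  · obtain ⟨hGi, hG⟩ := integral_exp_neg_half_sq_div_sq_tail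
    have hmpos : (0 : ℝ) < ((21 / 50) ^ 2 : ℝ) ^ (q - 1) := by positivity
    refine main (((21 / 50) ^ 2 : ℝ) ^ (q - 1))
      (fun u => ((21 / 50) ^ 2 : ℝ) ^ (q - 1) * (exp (-(1 / 2) * u ^ 2) / u ^ 2))
      (hGi.const_mul _) ?_ ?_
    · rw [integral_const_mul, ← mul_sub]
      exact mul_nonneg hmpos.le (by linarith)
    · intro u hu
      rcases le_or_gt u (37 / 20) with h | h
      · rw [Set.indicator_of_notMem (by simpa using h), sub_zero]
        exact rpow_mul_sub_le_rpow_sub_rpow (by positivity) (le_exp_neg_half_sq hu.le h)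
          (sq_nonneg _) (besselJ0_sq_le_exp hu.le h) h1
      · rw [Set.indicator_of_mem (by simpa using h)]
        have h3 : (besselJ0 u ^ 2) ^ q = (besselJ0 u ^ 2) ^ (q - 1) * besselJ0 u ^ 2 := by
          have := rpow_add_of_nonneg (sq_nonneg (besselJ0 u)) (sub_nonneg.2 h1) zero_le_one
          rwa [sub_add_cancel, rpow_one] at this
        have h4 : (besselJ0 u ^ 2) ^ (q - 1) ≤ ((21 / 50) ^ 2 : ℝ) ^ (q - 1) :=
          rpow_le_rpow (sq_nonneg _) (besselJ0_sq_le h.le) (by linarith)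
        have h5 : 0 ≤ exp (-(1 / 2) * u ^ 2) ^ q := by positivity
        have h6 := mul_le_mul_of_nonneg_right h4 (sq_nonneg (besselJ0 u))
        have h7 : ((21 / 50) ^ 2 : ℝ) ^ (q - 1) * (exp (-(1 / 2) * u ^ 2) / u ^ 2) * u ^ 2 =
            ((21 / 50) ^ 2 : ℝ) ^ (q - 1) * exp (-(1 / 2) * u ^ 2) := by
          field_simp
        rw [h3]
        simp only [h7]
        linarith
  -- Here `m = q`. Beyond `37/20`, with `D = (21/50)²`, adding `X^q ≥ qX` and `D^q - Y^q ≥ q(D - Y)`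
  -- leaves the constant error `D^q - qD`. Its cost `0.0275/1.85` is below `0.95 · 0.0198`.
  · have hD : ((21 / 50) ^ 2 : ℝ) ^ q - q * (21 / 50) ^ 2 ≤ 0.0275 := by
      have e1 : ((21 / 50) ^ 2 : ℝ) ^ q ≤ ((21 / 50) ^ 2 : ℝ) ^ (19 / 20 : ℝ) :=
        rpow_le_rpow_of_exponent_ge (by norm_num) (by norm_num) (by linarith)
      have e2 : ((21 / 50) ^ 2 : ℝ) ^ (19 / 20 : ℝ) ≤ 0.195 := by
        rw [show (19 / 20 : ℝ) = 19 * (1 / 20) by norm_num, rpow_mul (by norm_num),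
          show (0.195 : ℝ) = (0.195 ^ (20 : ℝ)) ^ (1 / 20 : ℝ) by
            rw [← rpow_mul (by norm_num)]; norm_num]
        refine rpow_le_rpow (by positivity) ?_ (by norm_num)
        norm_cast
        norm_num
      nlinarith
    have hint : IntegrableOn (fun u : ℝ => 0.0275 * u ^ (-2 : ℝ)) (Set.Ioi (37 / 20)) :=
      (integrableOn_Ioi_rpow_of_lt (by norm_num) (by norm_num)).const_mul _
    refine main q (fun u : ℝ => 0.0275 * u ^ (-2 : ℝ)) hint ?_ ?_
    · rw [integral_const_mul, integral_Ioi_rpow_of_lt (by norm_num) (by norm_num),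
        show (-2 + 1 : ℝ) = -1 by norm_num, rpow_neg_one]
      norm_num at hT ⊢
      nlinarith
    · intro u hu
      rcases le_or_gt u (37 / 20) with h | h
      · rw [Set.indicator_of_notMem (by simpa using h), sub_zero]
        exact mul_sub_le_rpow_sub_rpow (sq_nonneg _) (besselJ0_sq_le_exp hu.le h)
          (exp_le_one_iff.2 (by nlinarith [sq_nonneg u])) hq0 h1
      · rw [Set.indicator_of_mem (by simpa using h)]
        have h2 := mul_sub_le_rpow_sub_rpow (sq_nonneg (besselJ0 u)) (besselJ0_sq_le h.le)
          (by norm_num) hq0 h1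
        have h3 := mul_sub_le_rpow_sub_rpow le_rfl (exp_pos (-(1 / 2) * u ^ 2)).le
          (exp_le_one_iff.2 (by nlinarith [sq_nonneg u])) hq0 h1
        rw [zero_rpow hq0.ne'] at h3
        have h4 : (0.0275 : ℝ) * u ^ (-2 : ℝ) * u ^ 2 = 0.0275 := by
          rw [rpow_neg hu.le]
          norm_cast
          field_simp
        simp only [h4]
        linarith

/-! ### Khinchin's inequality when all coefficients are small -/

theorem abs_one_sub_prod_le {ι : Type*} (s : Finset ι) (f : ι → ℝ) (hf : ∀ k ∈ s, |f k| ≤ 1) :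
    |1 - ∏ k ∈ s, f k| ≤ ∑ k ∈ s, |1 - f k| := by
  classical
  induction s using Finset.induction_on with
  | empty => simp
  | insert a s ha ih =>
    rw [Finset.prod_insert ha, Finset.sum_insert ha]
    have h1 := ih fun k hk => hf k (Finset.mem_insert_of_mem hk)
    have h2 := hf a (Finset.mem_insert_self a s)
    calc |1 - f a * ∏ k ∈ s, f k| = |(1 - f a) + f a * (1 - ∏ k ∈ s, f k)| := by ring_nf
      _ ≤ |1 - f a| + |f a| * |1 - ∏ k ∈ s, f k| := by
          rw [← abs_mul]
          exact abs_add_le _ _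
      _ ≤ |1 - f a| + 1 * |1 - ∏ k ∈ s, f k| := by gcongr
      _ ≤ _ := by linarith

/-- AM-GM with weights `|c_k|²` bounds `∏ |J₀(t|c_k|)|` by the weighted sum of
`|J₀(t|c_k|)|^(1/|c_k|²)`. After rescaling by `|c_k|`, the one-variable inequality gives each
summand at least `|c_k|² √π/2`, and the weights add up to 1. -/
theorem sqrt_pi_div_two_le_of_small_coeffs (c : ι → ℂ) (hc : ∑ k, ‖c k‖ ^ 2 = 1)
    (hsmall : ∀ k, 1.9 * ‖c k‖ ^ 2 ≤ 1) :
    √π / 2 ≤ ∫ z, ‖steinhausSum c z‖ ∂steinhausPi ι := by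
  rw [integral_norm_steinhausSum]
  set F : ι → ℝ → ℝ := fun k t => ‖c k‖ ^ 2 *
    ((1 - (besselJ0 (t * ‖c k‖) ^ 2) ^ (1 / (2 * ‖c k‖ ^ 2))) / t ^ 2) with hF
  have hFint : ∀ k, IntegrableOn (F k) (Set.Ioi 0) ∧
      ‖c k‖ ^ 2 * (√π / 2) ≤ ∫ t in Set.Ioi (0 : ℝ), F k t := by
    intro k
    rcases (norm_nonneg (c k)).eq_or_lt with h0 | h0
    · simp [hF, ← h0]
    set a := ‖c k‖
    set q := 1 / (2 * a ^ 2)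
    have hq : 0.95 ≤ q := by
      rw [le_div_iff₀ (by positivity)]
      have := hsmall k
      linarith
    set f : ℝ → ℝ := fun u => (1 - (besselJ0 u ^ 2) ^ q) / u ^ 2 with hf
    have hFf : Set.EqOn (F k) (fun t => a ^ 4 * f (t * a)) (Set.Ioi 0) := by
      intro t ht
      have ht0 : t ≠ 0 := ne_of_gt ht
      have ha0 : a ≠ 0 := h0.ne'
      have e : ∀ x : ℝ, a ^ 2 * (x / t ^ 2) = a ^ 4 * (x / (t * a) ^ 2) := by
        intro x
        field_simp
      exact e _
    have hfint : IntegrableOn f (Set.Ioi 0) :=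
      integrableOn_one_sub_besselJ0_sq_rpow_div_sq (by linarith)
    have hcomp : IntegrableOn (fun t => f (t * a)) (Set.Ioi 0) := by
      have := (integrableOn_Ioi_comp_mul_right_iff f 0 h0).2
      rw [zero_mul] at this
      exact this hfint
    refine ⟨(integrableOn_congr_fun hFf measurableSet_Ioi).2 (hcomp.const_mul _), ?_⟩
    rw [setIntegral_congr_fun measurableSet_Ioi hFf, integral_const_mul,
      integral_comp_mul_right_Ioi f 0 h0, zero_mul, smul_eq_mul]
    have key := sqrt_le_integral_one_sub_besselJ0_sq_rpow hq
    have e : √(π * (q / 2)) = √π / 2 / a := by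
      rw [show π * (q / 2) = π / (2 * a) ^ 2 by simp only [q]; field_simp,
        sqrt_div pi_nonneg, sqrt_sq (by positivity)]
      field_simp
    rw [e] at key
    calc a ^ 2 * (√π / 2) = a ^ 4 * (a⁻¹ * (√π / 2 / a)) := by field_simp
      _ ≤ _ := by gcongr
  have hJ := continuous_besselJ0.measurable
  have hprod : ∀ t : ℝ, |∏ k, besselJ0 (t * ‖c k‖)| ≤
      ∑ k, ‖c k‖ ^ 2 * (besselJ0 (t * ‖c k‖) ^ 2) ^ (1 / (2 * ‖c k‖ ^ 2)) := by
    intro t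
    have h := geom_mean_le_arith_mean_weighted Finset.univ (fun k => ‖c k‖ ^ 2)
      (fun k => (besselJ0 (t * ‖c k‖) ^ 2) ^ (1 / (2 * ‖c k‖ ^ 2)))
      (fun k _ => by positivity) hc (fun k _ => by positivity)
    refine le_trans (le_of_eq ?_) h
    rw [Finset.abs_prod]
    refine Finset.prod_congr rfl fun k _ => ?_
    rcases eq_or_ne ‖c k‖ 0 with h0 | h0
    · simp [h0, besselJ0_zero]
    · rw [← rpow_mul (sq_nonneg _), ← sq_abs, ← rpow_natCast, ← rpow_mul (abs_nonneg _)]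
      have : ((2 : ℕ) : ℝ) * (1 / (2 * ‖c k‖ ^ 2) * ‖c k‖ ^ 2) = 1 := by
        push_cast
        field_simp
      rw [this, rpow_one]
  have hle := setIntegral_mono_on (f := fun t => ∑ k, F k t)
    (g := fun t => (1 - ∏ k, besselJ0 (t * ‖c k‖)) / t ^ 2)
    (integrable_finsetSum _ fun k _ => (hFint k).1) ?_ measurableSet_Ioi ?_
  · rw [integral_finsetSum _ fun k _ => (hFint k).1] at hle
    refine le_trans ?_ hle
    calc √π / 2 = ∑ k, ‖c k‖ ^ 2 * (√π / 2) := by rw [← Finset.sum_mul, hc, one_mul]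
      _ ≤ _ := Finset.sum_le_sum fun k _ => (hFint k).2
  · refine integrableOn_div_sq (by fun_prop) (C := 1 / 4) (D := 2) (by norm_num) (by norm_num)
      (fun t ht => ?_) (fun t _ => ?_)
    · refine (abs_one_sub_prod_le _ _ fun k _ => abs_besselJ0_le_one _).trans ?_
      calc ∑ k, |1 - besselJ0 (t * ‖c k‖)| ≤ ∑ k, (t * ‖c k‖) ^ 2 / 4 :=
            Finset.sum_le_sum fun k _ => (abs_one_sub_besselJ0_le (by positivity)).1
        _ = 1 / 4 * t ^ 2 := by
            simp only [mul_pow]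
            rw [← Finset.sum_div, ← Finset.mul_sum, hc]
            ring
    · have : |∏ k, besselJ0 (t * ‖c k‖)| ≤ 1 := by
        rw [Finset.abs_prod]
        exact Finset.prod_le_one (fun _ _ => abs_nonneg _) fun _ _ => abs_besselJ0_le_one _
      rw [abs_le] at this ⊢
      constructor <;> linarith [this.1, this.2]
  · intro t ht
    have ht0 : (0 : ℝ) < t := ht
    simp only [hF, ← mul_div_assoc]
    rw [← Finset.sum_div]
    gcongr
    simp only [mul_sub, mul_one]
    rw [Finset.sum_sub_distrib, hc]
    linarith [(abs_le.1 (hprod t)).2]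

/-! ### Khinchin's inequality when one coefficient is large -/

theorem integral_re_steinhaus {f : ℂ → ℂ} (hf : DifferentiableOn ℂ f (Metric.closedBall 0 1)) :
    ∫ z : Circle, (f z).re ∂steinhaus = (f 0).re := by
  have hc : Continuous fun z : Circle => f z :=
    hf.continuousOn.comp_continuous (by fun_prop) (fun z => by simp [Circle.norm_coe])
  have h1 : ∫ z : Circle, f z ∂steinhaus = f 0 := by
    rw [integral_steinhaus hc]
    have hd : DiffContOnCl ℂ f (Metric.ball 0 |1|) :=
      DifferentiableOn.diffContOnCl_ball (U := Metric.closedBall 0 1) hf (by simp)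
    rw [← hd.circleAverage, circleAverage_def]
    simp [circleMap]
  rw [← h1]
  exact integral_re (𝕜 := ℂ) (integrable_of_continuous_of_compact hc)

/-- Let `q = 1 + w/2 - w²/8`, the Taylor polynomial of `√(1 + w)` at `w = rz`; it has no zero in the
closed disc. Then `|1 + w| ≥ Re((1 + w) q̄/q)` and `1 + w = q² + w³(1/8 - w/64)`. The term `|q|²`
has mean `1 + r²/4 + r⁴/64`. On the circle `z² q̄` is a polynomial in `z`, so the remaining term is
the boundary value of a holomorphic function vanishing at 0 and has mean 0. `Φ` collects this term
and the nonconstant part of `|q|²`. -/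
theorem norm_one_add_lower_bound {r : ℝ} (hr0 : 0 ≤ r) (hr1 : r ≤ 1) :
    1 + r ^ 2 / 4 + r ^ 4 / 64 ≤ ∫ z : Circle, ‖1 + r * (z : ℂ)‖ ∂steinhaus := by
  set q : ℂ → ℂ := fun z => 1 + r * z / 2 - (r * z) ^ 2 / 8 with hq
  set Φ : ℂ → ℂ := fun z => r * z - r ^ 2 * z ^ 2 / 4 - r ^ 3 * z / 8 +
    r ^ 3 * z * (1 / 8 - r * z / 64) * (z ^ 2 + r * z / 2 - r ^ 2 / 8) / q z with hΦ
  have hq0 : ∀ z ∈ Metric.closedBall (0 : ℂ) 1, q z ≠ 0 := by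
    intro z hz h0
    rw [mem_closedBall_zero_iff] at hz
    have hw : ‖(r : ℂ) * z‖ ≤ 1 := by
      rw [norm_mul, Complex.norm_real, norm_of_nonneg hr0]
      exact mul_le_one₀ hr1 (norm_nonneg z) hz
    have h1 : (1 : ℂ) = (r * z) ^ 2 / 8 - r * z / 2 := by
      simp only [hq] at h0
      linear_combination h0
    have h2 := norm_sub_le ((r * z : ℂ) ^ 2 / 8) (r * z / 2)
    rw [← h1, norm_div, norm_div, norm_pow] at h2
    have hx0 := norm_nonneg ((r : ℂ) * z)
    generalize ‖(r : ℂ) * z‖ = x at h2 hw hx0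
    norm_num at h2
    nlinarith
  have hΦd : DifferentiableOn ℂ Φ (Metric.closedBall 0 1) := by
    intro z hz
    refine DifferentiableAt.differentiableWithinAt ?_
    have : q z ≠ 0 := hq0 z hz
    have hqd : DifferentiableAt ℂ q z := by fun_prop
    fun_prop (disch := assumption)
  have hpt : ∀ z : Circle, 1 + r ^ 2 / 4 + r ^ 4 / 64 + (Φ z).re ≤ ‖1 + r * (z : ℂ)‖ := by
    intro z
    have hqz : q z ≠ 0 := hq0 z (by simp [Circle.norm_coe])
    obtain ⟨y, hy⟩ : ∃ y : ℂ, y = (starRingEnd ℂ) (z : ℂ) := ⟨_, rfl⟩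
    have hzy : (z : ℂ) * y = 1 := by
      rw [hy, Complex.mul_conj, Circle.normSq_coe, Complex.ofReal_one]
    have hqc : (starRingEnd ℂ) (q z) = 1 + r * y / 2 - (r * y) ^ 2 / 8 := by
      simp only [hq, hy, map_sub, map_add, map_div₀, map_mul, map_pow, map_one, map_ofNat,
        Complex.conj_ofReal]
    have e1 : (1 + r * z : ℂ) * (starRingEnd ℂ) (q z) / q z =
        q z * (starRingEnd ℂ) (q z) + r ^ 3 * z * (1 / 8 - r * z / 64) *
          (z ^ 2 + r * z / 2 - r ^ 2 / 8) / q z := by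
      have e0 : r ^ 3 * (z : ℂ) ^ 3 * (1 / 8 - r * z / 64) * (starRingEnd ℂ) (q z) =
          r ^ 3 * z * (1 / 8 - r * z / 64) * (z ^ 2 + r * z / 2 - r ^ 2 / 8) := by
        rw [hqc]
        linear_combination (r ^ 3 * z * (1 / 8 - r * z / 64) * (r * z / 2 - r ^ 2 / 8 *
          (z * y + 1)) : ℂ) * hzy
      have alg : (1 + r * z : ℂ) = q z ^ 2 + r ^ 3 * (z : ℂ) ^ 3 * (1 / 8 - r * z / 64) := by
        simp only [hq]
        ring
      rw [alg, ← e0]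
      field_simp
    have e2 : (q z * (starRingEnd ℂ) (q z)).re = 1 + r ^ 2 / 4 + r ^ 4 / 64 +
        (r * z - r ^ 2 * z ^ 2 / 4 - r ^ 3 * z / 8 : ℂ).re := by
      have h1 : q z * (starRingEnd ℂ) (q z) = ((1 + r ^ 2 / 4 + r ^ 4 / 64 +
          (r * z - r ^ 2 * z ^ 2 / 4 - r ^ 3 * z / 8 : ℂ).re : ℝ) : ℂ) := by
        rw [Complex.ofReal_add, Complex.re_eq_add_conj]
        simp only [map_sub, map_div₀, map_mul, map_pow, map_ofNat, Complex.conj_ofReal, ← hy]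
        rw [hqc]
        simp only [hq]
        push_cast
        linear_combination (r ^ 2 / 4 - r ^ 3 * (z + y) / 16 + r ^ 4 * (z * y + 1) / 64 : ℂ) * hzy
      rw [h1, Complex.ofReal_re]
    have e3 : ((1 + r * z : ℂ) * (starRingEnd ℂ) (q z) / q z).re =
        1 + r ^ 2 / 4 + r ^ 4 / 64 + (Φ z).re := by
      rw [e1, Complex.add_re, e2, hΦ, Complex.add_re]
      ring
    rw [← e3]
    refine (Complex.re_le_norm _).trans (le_of_eq ?_)
    rw [norm_div, norm_mul, RCLike.norm_conj, mul_div_assoc, div_self (norm_ne_zero_iff.2 hqz),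
      mul_one]
  have hΦc : Continuous fun z : Circle => (Φ z).re := Complex.continuous_re.comp
    (hΦd.continuousOn.comp_continuous (by fun_prop) (fun z => by simp [Circle.norm_coe]))
  have h := integral_mono (μ := steinhaus)
    (integrable_of_continuous_of_compact (by fun_prop))
    (integrable_of_continuous_of_compact (by fun_prop)) hpt
  rw [integral_add (integrable_const _) (integrable_of_continuous_of_compact hΦc),
    integral_re_steinhaus hΦd] at h
  simpa [hΦ] using h

theorem norm_add_mul_circle_symm (a b : ℝ) (z : Circle) :
    ‖(a : ℂ) + b * z‖ = ‖(b : ℂ) + a * z‖ := by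
  have hn : (z : ℂ).re * (z : ℂ).re + (z : ℂ).im * (z : ℂ).im = 1 := Circle.normSq_coe z
  rw [Complex.norm_def, Complex.norm_def]
  congr 1
  simp [Complex.normSq_apply]
  linear_combination (b ^ 2 - a ^ 2) * hn

/-- A minorant quadratic in `r²`, valid for all `r ≥ 0`, can be averaged knowing only second and
fourth moments. The case `r ≥ 1` reduces to `1/r` by the symmetry `|1 + rz| = |r + z|`. -/
theorem norm_one_add_quadratic_lower_bound {r : ℝ} (hr0 : 0 ≤ r) :
    0.981 + 0.284 * r ^ 2 - 0.006 * r ^ 4 ≤ ∫ z : Circle, ‖1 + r * (z : ℂ)‖ ∂steinhaus := by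
  rcases le_total r 1 with h1 | h1
  · refine le_trans ?_ (norm_one_add_lower_bound hr0 h1)
    nlinarith [sq_nonneg (r ^ 2 - 0.786)]
  · have hr : 0 < r := by linarith
    have e : ∀ z : Circle, ‖1 + r * (z : ℂ)‖ = r * ‖1 + ((r⁻¹ : ℝ) : ℂ) * z‖ := by
      intro z
      have := norm_add_mul_circle_symm 1 r z
      rw [Complex.ofReal_one] at this
      rw [this]
      nth_rewrite 2 [← norm_of_nonneg hr.le]
      rw [← Complex.norm_real, ← norm_mul, mul_add, ← mul_assoc, ← Complex.ofReal_mul,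
        mul_inv_cancel₀ hr.ne']
      simp
    simp only [e]
    rw [integral_const_mul]
    have h := norm_one_add_lower_bound (inv_nonneg.2 hr0) (inv_le_one_of_one_le₀ h1)
    refine le_trans ?_ (mul_le_mul_of_nonneg_left h hr0)
    have e2 : r * (1 + r⁻¹ ^ 2 / 4 + r⁻¹ ^ 4 / 64) =
        (64 * r ^ 4 + 16 * r ^ 2 + 1) / (64 * r ^ 3) := by
      field_simp
      ring
    rw [e2, le_div_iff₀ (by positivity)]
    rcases le_total r 2 with h2 | h2
    · obtain ⟨y, rfl⟩ : ∃ y, r = 1 + y := ⟨r - 1, by ring⟩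
      have hy0 : 0 ≤ y := by linarith
      have hy1 : 0 ≤ 1 - y := by linarith
      have h3 := mul_nonneg (pow_nonneg hy0 3) hy1
      have h4 := mul_nonneg (pow_nonneg hy0 4) hy1
      nlinarith [pow_nonneg hy0 2, pow_nonneg hy0 3, pow_nonneg hy0 6, pow_nonneg hy0 7]
    · have hc : 0 ≤ 0.018 - 0.073 * r + 0.041 * r ^ 2 + 0.006 * r ^ 3 := by
        nlinarith [pow_nonneg hr0 3]
      have key : 0 ≤ 0.006 * r ^ 5 - 0.284 * r ^ 3 + r ^ 2 - 0.981 * r + 0.25 := by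
        -- The quintic is nearly tangent to zero at `r = 3.425`, hence the square times a cubic that
        -- is nonnegative for `r ≥ 2`.
        nlinarith [mul_nonneg hc (sq_nonneg (r - 3.425))]
      nlinarith [mul_nonneg key (sq_nonneg r)]

theorem integral_norm_mul_add_steinhaus_lower_bound {c : ℂ} (hc : c ≠ 0) (w : ℂ) :
    ‖c‖ * (0.981 + 0.284 * (‖w‖ / ‖c‖) ^ 2 - 0.006 * (‖w‖ / ‖c‖) ^ 4) ≤
      ∫ z : Circle, ‖c * (z : ℂ) + w‖ ∂steinhaus := by
  have hc0 : 0 < ‖c‖ := norm_pos_iff.2 hc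
  have hr : (0 : ℝ) ≤ ‖w‖ / ‖c‖ := by positivity
  obtain ⟨u, hu⟩ : ∃ u : Circle, w / c = ((‖w‖ / ‖c‖ : ℝ) : ℂ) * u := by
    refine ⟨Circle.exp (w / c).arg, ?_⟩
    rw [← norm_div, Circle.coe_exp, Complex.norm_mul_exp_arg_mul_I]
  rw [← integral_comp_mul_steinhaus (by fun_prop) u]
  have e : ∀ z : Circle, ‖c * ((u * z : Circle) : ℂ) + w‖ =
      ‖c‖ * ‖1 + ((‖w‖ / ‖c‖ : ℝ) : ℂ) * (z : ℂ)‖ := by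
    intro z
    have h1 := norm_add_mul_circle_symm 1 (‖w‖ / ‖c‖) z
    rw [Complex.ofReal_one] at h1
    have h2 : c * ((u * z : Circle) : ℂ) + w = c * u * (((‖w‖ / ‖c‖ : ℝ) : ℂ) + 1 * z) := by
      rw [Circle.coe_mul]
      have h3 : w = c * (w / c) := by field_simp
      rw [hu] at h3
      linear_combination h3
    rw [h1, h2, norm_mul, norm_mul, Circle.norm_coe, mul_one]
  simp only [e]
  rw [integral_const_mul]
  exact mul_le_mul_of_nonneg_left (norm_one_add_quadratic_lower_bound hr) hc0.le

theorem norm_mul_add_sq_circle (c w : ℂ) (z : Circle) : ‖c * (z : ℂ) + w‖ ^ 2 =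
    ‖c‖ ^ 2 + ‖w‖ ^ 2 + 2 * (c * (starRingEnd ℂ) w * z).re := by
  have hn : (z : ℂ).re * (z : ℂ).re + (z : ℂ).im * (z : ℂ).im = 1 := Circle.normSq_coe z
  simp only [← Complex.normSq_eq_norm_sq, Complex.normSq_apply, Complex.add_re, Complex.add_im,
    Complex.mul_re, Complex.mul_im, Complex.conj_re, Complex.conj_im]
  linear_combination (c.re ^ 2 + c.im ^ 2) * hn

theorem integral_norm_mul_add_sq_steinhaus (c w : ℂ) :
    ∫ z : Circle, ‖c * (z : ℂ) + w‖ ^ 2 ∂steinhaus = ‖c‖ ^ 2 + ‖w‖ ^ 2 := by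
  simp only [norm_mul_add_sq_circle]
  rw [integral_add (integrable_const _) (integrable_of_continuous_of_compact (by fun_prop)),
    integral_const_mul, integral_re_steinhaus (f := fun z => c * (starRingEnd ℂ) w * z)
      (by fun_prop)]
  simp

theorem integral_norm_mul_add_pow_four_steinhaus (c w : ℂ) :
    ∫ z : Circle, ‖c * (z : ℂ) + w‖ ^ 4 ∂steinhaus =
      ‖c‖ ^ 4 + 4 * ‖c‖ ^ 2 * ‖w‖ ^ 2 + ‖w‖ ^ 4 := by
  have e : ∀ z : Circle, ‖c * (z : ℂ) + w‖ ^ 4 =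
      (((‖c‖ ^ 4 + 4 * ‖c‖ ^ 2 * ‖w‖ ^ 2 + ‖w‖ ^ 4 : ℝ) : ℂ) +
        4 * ((‖c‖ ^ 2 + ‖w‖ ^ 2 : ℝ) : ℂ) * (c * (starRingEnd ℂ) w) * z +
        2 * (c * (starRingEnd ℂ) w) ^ 2 * z ^ 2).re := by
    intro z
    have hsq : ∀ x : ℂ, x.re ^ 2 = (‖x‖ ^ 2 + (x ^ 2).re) / 2 := by
      intro x
      rw [← Complex.normSq_eq_norm_sq, Complex.normSq_apply, pow_two x, Complex.mul_re]
      ring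
    have h1 := hsq (c * (starRingEnd ℂ) w * z)
    rw [norm_mul, norm_mul, RCLike.norm_conj, Circle.norm_coe, mul_one] at h1
    have h2 := norm_mul_add_sq_circle c w z
    have e4 : ‖c * (z : ℂ) + w‖ ^ 4 = (‖c * (z : ℂ) + w‖ ^ 2) ^ 2 := by ring
    rw [e4, h2]
    have e5 : (((‖c‖ ^ 4 + 4 * ‖c‖ ^ 2 * ‖w‖ ^ 2 + ‖w‖ ^ 4 : ℝ) : ℂ) +
        4 * ((‖c‖ ^ 2 + ‖w‖ ^ 2 : ℝ) : ℂ) * (c * (starRingEnd ℂ) w) * z +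
        2 * (c * (starRingEnd ℂ) w) ^ 2 * z ^ 2) =
        ((‖c‖ ^ 4 + 4 * ‖c‖ ^ 2 * ‖w‖ ^ 2 + ‖w‖ ^ 4 : ℝ) : ℂ) +
        ((4 * (‖c‖ ^ 2 + ‖w‖ ^ 2) : ℝ) : ℂ) * (c * (starRingEnd ℂ) w * z) +
        ((2 : ℝ) : ℂ) * (c * (starRingEnd ℂ) w * z) ^ 2 := by
      push_cast
      ring
    rw [e5, Complex.add_re, Complex.add_re, Complex.ofReal_re, Complex.re_ofReal_mul,
      Complex.re_ofReal_mul]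
    linear_combination 4 * h1
  simp only [e]
  rw [integral_re_steinhaus (f := fun z => ((‖c‖ ^ 4 + 4 * ‖c‖ ^ 2 * ‖w‖ ^ 2 + ‖w‖ ^ 4 : ℝ) : ℂ) +
        4 * ((‖c‖ ^ 2 + ‖w‖ ^ 2 : ℝ) : ℂ) * (c * (starRingEnd ℂ) w) * z +
        2 * (c * (starRingEnd ℂ) w) ^ 2 * z ^ 2) (by fun_prop)]
  simp only [mul_zero, add_zero, Complex.ofReal_re, ne_eq, OfNat.ofNat_ne_zero, not_false_eq_true,
    zero_pow]

theorem steinhausSum_insertNth {n : ℕ} (i : Fin (n + 1)) (c : Fin (n + 1) → ℂ) (ζ : Circle)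
    (z : Fin n → Circle) :
    steinhausSum c (i.insertNth ζ z) = c i * ζ + steinhausSum (fun k => c (i.succAbove k)) z := by
  simp [steinhausSum, Fin.sum_univ_succAbove _ i]

theorem integral_norm_sq_steinhausSum : ∀ {n : ℕ} (c : Fin n → ℂ),
    ∫ z, ‖steinhausSum c z‖ ^ 2 ∂steinhausPi (Fin n) = ∑ k, ‖c k‖ ^ 2
  | 0, c => by simp [steinhausSum]
  | n + 1, c => by
    rw [integral_steinhausPi_insertNth 0 (by fun_prop)]
    simp only [steinhausSum_insertNth, integral_norm_mul_add_sq_steinhaus]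
    rw [integral_add (integrable_const _) (integrable_of_continuous_of_compact (by fun_prop)),
      integral_norm_sq_steinhausSum, Fin.sum_univ_succ]
    simp

theorem integral_norm_pow_four_steinhausSum_le : ∀ {n : ℕ} (c : Fin n → ℂ),
    ∫ z, ‖steinhausSum c z‖ ^ 4 ∂steinhausPi (Fin n) ≤ 2 * (∑ k, ‖c k‖ ^ 2) ^ 2
  | 0, c => by simp [steinhausSum]
  | n + 1, c => by
    rw [integral_steinhausPi_insertNth 0 (by fun_prop)]
    simp only [steinhausSum_insertNth, integral_norm_mul_add_pow_four_steinhaus]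
    rw [integral_add (integrable_of_continuous_of_compact (by fun_prop))
      (integrable_of_continuous_of_compact (by fun_prop)),
      integral_add (integrable_const _) (integrable_of_continuous_of_compact (by fun_prop)),
      integral_const_mul, integral_norm_sq_steinhausSum, Fin.sum_univ_succ]
    have h := integral_norm_pow_four_steinhausSum_le (fun k => c (Fin.succAbove 0 k))
    simp only [Fin.succAbove_zero, integral_const, probReal_univ, smul_eq_mul, one_mul] at h ⊢
    nlinarith [sq_nonneg (‖c 0‖ ^ 2)]

/-- Integrate the minorant over `z_i` first. With `a = |c_i|`, `B = 1 - a²` and `y = B/a² ≤ 0.9`,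
the moments `E|S'|² = B` and `E|S'|⁴ ≤ 2B²` leave `a (0.981 + 0.284 y - 0.012 y²)`. As `a² = 1/(1 +
y)`, its square is compared with `π/4 · (1 + y)`. -/
theorem sqrt_pi_div_two_le_of_large_coeff {n : ℕ} (c : Fin (n + 1) → ℂ)
    (hc : ∑ k, ‖c k‖ ^ 2 = 1) (i : Fin (n + 1)) (hi : 1 ≤ 1.9 * ‖c i‖ ^ 2) :
    √π / 2 ≤ ∫ z, ‖steinhausSum c z‖ ∂steinhausPi (Fin (n + 1)) := by
  have ha : 0 < ‖c i‖ := by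
    rcases (norm_nonneg (c i)).eq_or_lt with h | h
    · rw [← h] at hi
      norm_num at hi
    · exact h
  rw [integral_steinhausPi_insertNth i (by fun_prop)]
  simp only [steinhausSum_insertNth]
  set c' := fun k => c (i.succAbove k)
  have h2 := integral_norm_sq_steinhausSum c'
  have h4 := integral_norm_pow_four_steinhausSum_le c'
  rw [Fin.sum_univ_succAbove _ i] at hc
  set B := ∑ k, ‖c' k‖ ^ 2
  set a := ‖c i‖
  have hle := integral_mono (μ := steinhausPi (Fin n))
    (f := fun z => a * (0.981 + 0.284 * (‖steinhausSum c' z‖ / a) ^ 2 -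
      0.006 * (‖steinhausSum c' z‖ / a) ^ 4))
    (g := fun z => ∫ ζ : Circle, ‖c i * (ζ : ℂ) + steinhausSum c' z‖ ∂steinhaus)
    (integrable_of_continuous_of_compact (by fun_prop))
    ?_ (fun z => integral_norm_mul_add_steinhaus_lower_bound (norm_pos_iff.1 ha) _)
  · refine le_trans ?_ hle
    simp only [div_pow, mul_div_assoc']
    rw [integral_const_mul, integral_sub (integrable_of_continuous_of_compact (by fun_prop))
      (integrable_of_continuous_of_compact (by fun_prop)), integral_add (integrable_const _)
      (integrable_of_continuous_of_compact (by fun_prop)), integral_div, integral_div,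
      integral_const_mul, integral_const_mul, h2]
    simp only [integral_const, probReal_univ, smul_eq_mul, one_mul]
    set y := B / a ^ 2 with hy
    have hy0 : 0 ≤ y := by positivity
    have hay : a ^ 2 * (1 + y) = 1 := by
      rw [hy]
      field_simp
      exact hc
    have hy1 : y ≤ 0.9 := by
      rw [hy, div_le_iff₀ (by positivity)]
      linarith
    have h5 : (0.006 * ∫ z, ‖steinhausSum c' z‖ ^ 4 ∂steinhausPi (Fin n)) / a ^ 4 ≤
        0.012 * y ^ 2 := by
      rw [div_le_iff₀ (by positivity), hy]
      have : 0.012 * (B / a ^ 2) ^ 2 * a ^ 4 = 0.006 * (2 * B ^ 2) := by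
        field_simp
        ring
      rw [this]
      gcongr
    have h6 : 0.284 * B / a ^ 2 = 0.284 * y := by rw [hy, mul_div_assoc]
    rw [h6]
    have h7 : (0 : ℝ) ≤ 0.981 + 0.284 * y - 0.012 * y ^ 2 := by nlinarith
    have h8 : √π / 2 ≤ a * (0.981 + 0.284 * y - 0.012 * y ^ 2) := by
      apply le_of_sq_le_sq _ (by positivity)
      rw [div_pow, sq_sqrt pi_nonneg, mul_pow]
      have hpi := pi_lt_d4
      have h9 : (0.981 + 0.2732 * y) ^ 2 ≤ (0.981 + 0.284 * y - 0.012 * y ^ 2) ^ 2 := by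
        gcongr
        nlinarith
      have h10 : π / 4 * (1 + y) ≤ (0.981 + 0.284 * y - 0.012 * y ^ 2) ^ 2 := by
        nlinarith
      calc π / 2 ^ 2 = a ^ 2 * (π / 4 * (1 + y)) := by
            linear_combination (-π / 4) * hay
        _ ≤ _ := by gcongr
    refine h8.trans ?_
    gcongr
  · exact (integrable_of_continuous_of_compact (μ := (steinhausPi (Fin n)).prod steinhaus)
      (f := fun p => ‖c i * (p.2 : ℂ) + steinhausSum c' p.1‖) (by fun_prop)).integral_prod_left

/-! ### The sharp Khinchin inequality and the lower bound for the game -/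

/-- Khinchin's inequality for Steinhaus variables with the best constant. -/
theorem steinhaus_khinchin {n : ℕ} (c : Fin n → ℂ) :
    √π / 2 * √(∑ k, ‖c k‖ ^ 2) ≤ ∫ z, ‖steinhausSum c z‖ ∂steinhausPi (Fin n) := by
  set σ := √(∑ k, ‖c k‖ ^ 2) with hσ
  have hσ2 : σ ^ 2 = ∑ k, ‖c k‖ ^ 2 := sq_sqrt (by positivity)
  rcases (sqrt_nonneg (∑ k, ‖c k‖ ^ 2)).eq_or_lt with h0 | h0
  · rw [hσ, ← h0, mul_zero]
    positivity
  change 0 < σ at h0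
  set c' : Fin n → ℂ := fun k => (σ⁻¹ : ℝ) * c k with hc'
  have hnorm : ∀ k, ‖c' k‖ = σ⁻¹ * ‖c k‖ := fun k => by
    rw [hc', norm_mul, Complex.norm_real, norm_of_nonneg (inv_nonneg.2 h0.le)]
  have hsum : ∑ k, ‖c' k‖ ^ 2 = 1 := by
    simp only [hnorm, mul_pow]
    rw [← Finset.mul_sum, ← hσ2]
    field_simp
  have key : √π / 2 ≤ ∫ z, ‖steinhausSum c' z‖ ∂steinhausPi (Fin n) := by
    by_cases h : ∀ k, 1.9 * ‖c' k‖ ^ 2 ≤ 1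
    · exact sqrt_pi_div_two_le_of_small_coeffs c' hsum h
    · push Not at h
      obtain ⟨i, hi⟩ := h
      cases n with
      | zero => exact i.elim0
      | succ n => exact sqrt_pi_div_two_le_of_large_coeff c' hsum i hi.le
  have hS : ∀ z, ‖steinhausSum c' z‖ = σ⁻¹ * ‖steinhausSum c z‖ := by
    intro z
    simp only [steinhausSum, hc', mul_assoc]
    rw [← Finset.mul_sum, norm_mul, Complex.norm_real, norm_of_nonneg (inv_nonneg.2 h0.le)]
  simp only [hS] at key
  rw [integral_const_mul, inv_mul_eq_div, le_div_iff₀ h0] at key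
  exact key

/-- The norm of the mean of the vector `(|S_i|)_i` in `ℓ²` is at most the mean of its norm; each
coordinate of the mean is bounded by scalar Khinchin. -/
theorem steinhaus_khinchin_l2 {κ : Type*} [Fintype κ] {n : ℕ} (c : κ → Fin n → ℂ) :
    √π / 2 * √(∑ i, ∑ k, ‖c i k‖ ^ 2) ≤
      ∫ z, √(∑ i, ‖steinhausSum (c i) z‖ ^ 2) ∂steinhausPi (Fin n) := by
  set V : (Fin n → Circle) → EuclideanSpace ℝ κ := fun z =>
    WithLp.toLp 2 fun i => ‖steinhausSum (c i) z‖ with hV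
  have hVc : Continuous V := by fun_prop
  have hVi : Integrable V (steinhausPi (Fin n)) := integrable_of_continuous_of_compact hVc
  have hnorm : ∀ z, ‖V z‖ = √(∑ i, ‖steinhausSum (c i) z‖ ^ 2) := by
    intro z
    rw [EuclideanSpace.norm_eq]
    simp [hV]
  have hcoord : ∀ i, (∫ z, V z ∂steinhausPi (Fin n)) i =
      ∫ z, ‖steinhausSum (c i) z‖ ∂steinhausPi (Fin n) := by
    intro i
    exact ((EuclideanSpace.proj (𝕜 := ℝ) i).integral_comp_comm hVi).symm
  have h := norm_integral_le_integral_norm (μ := steinhausPi (Fin n)) V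
  simp only [hnorm] at h
  refine le_trans ?_ h
  rw [EuclideanSpace.norm_eq]
  apply le_sqrt_of_sq_le
  rw [mul_pow, sq_sqrt (by positivity), Finset.mul_sum]
  refine Finset.sum_le_sum fun i _ => ?_
  rw [hcoord, norm_of_nonneg (by positivity)]
  have := pow_le_pow_left₀ (by positivity) (steinhaus_khinchin (c i)) 2
  rwa [mul_pow, sq_sqrt (by positivity)] at this

theorem exists_circle_l2_lower_bound {ι κ : Type*} [Fintype ι] [Fintype κ] {n : ℕ}
    (c : ι → κ → Fin n → ℂ) : ∃ z : Fin n → Circle,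
      √π / 2 * ∑ i, √(∑ j, ∑ k, ‖c i j k‖ ^ 2) ≤
        ∑ i, √(∑ j, ‖∑ k, c i j k * (z k : ℂ)‖ ^ 2) := by
  have hint : ∀ i, Integrable (fun z => √(∑ j, ‖steinhausSum (c i j) z‖ ^ 2))
      (steinhausPi (Fin n)) := fun i => integrable_of_continuous_of_compact (by fun_prop)
  obtain ⟨z, hz⟩ := exists_integral_le (integrable_finsetSum Finset.univ fun i _ => hint i)
  refine ⟨z, le_trans ?_ hz⟩
  rw [integral_finsetSum _ fun i _ => hint i, Finset.mul_sum]
  exact Finset.sum_le_sum fun i _ => steinhaus_khinchin_l2 (c i)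

theorem sum_eq_sum_insertNth {m : ℕ} {n : Fin (m + 1) → ℕ} {M : Type*} [AddCommMonoid M]
    (p : Fin (m + 1)) (f : ((k : Fin (m + 1)) → Fin (n k)) → M) :
    ∑ j, f j = ∑ i, ∑ j : (k : Fin m) → Fin (n (p.succAbove k)), f (p.insertNth i j) := by
  rw [← Fintype.sum_prod_type', ← (Fin.insertNthEquiv (fun k => Fin (n k)) p).sum_comp]
  rfl

/-- Induction on the directions. Each fixes one family of knobs doing at least as well as the
average, removes that index from the inner `ℓ²` norm and costs `√π/2`. The outer index `i` is the
direction kept for aligning phases. -/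
theorem exists_knobs_lower_bound : ∀ {m : ℕ} {n : Fin m → ℕ} {ι : Type} [Fintype ι]
    (c : ι → ((k : Fin m) → Fin (n k)) → ℂ), ∃ x : Knobs n,
      (√π / 2) ^ m * ∑ i, √(∑ j, ‖c i j‖ ^ 2) ≤ ∑ i, ‖∑ j, c i j * ∏ k, (x k (j k) : ℂ)‖
  | 0, n, ι, _, c => ⟨fun k => k.elim0, by simp [sqrt_sq]⟩
  | m + 1, n, ι, _, c => by
    obtain ⟨z, hz⟩ := exists_circle_l2_lower_bound
      (fun i (j : (k : Fin m) → Fin (n (Fin.succAbove 0 k))) (l : Fin (n 0)) =>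
        c i (Fin.insertNth 0 l j))
    obtain ⟨x, hx⟩ := exists_knobs_lower_bound
      (fun i (j : (k : Fin m) → Fin (n (Fin.succAbove 0 k))) =>
        ∑ l : Fin (n 0), c i (Fin.insertNth 0 l j) * (z l : ℂ))
    refine ⟨Fin.insertNth (α := fun k => Fin (n k) → Circle) 0 z x, ?_⟩
    have e : ∀ i, ∑ j, c i j * ∏ k, ((Fin.insertNth (α := fun k => Fin (n k) → Circle) 0 z x
        k (j k) : Circle) : ℂ) = ∑ j : (k : Fin m) → Fin (n (Fin.succAbove 0 k)),
          (∑ l : Fin (n 0), c i (Fin.insertNth 0 l j) * (z l : ℂ)) * ∏ k, (x k (j k) : ℂ) := by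
      intro i
      rw [sum_eq_sum_insertNth 0, Finset.sum_comm]
      refine Finset.sum_congr rfl fun j _ => ?_
      rw [Finset.sum_mul]
      refine Finset.sum_congr rfl fun l _ => ?_
      rw [Fin.prod_univ_succAbove _ 0]
      simp only [Fin.insertNth_apply_same, Fin.insertNth_apply_succAbove]
      ring
    simp only [e]
    refine le_trans ?_ hx
    rw [pow_succ, mul_assoc]
    refine mul_le_mul_of_nonneg_left (le_trans (le_of_eq ?_) hz) (by positivity)
    simp only [sum_eq_sum_insertNth (n := n) 0]
    congr 1
    refine Finset.sum_congr rfl fun i _ => ?_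
    rw [Finset.sum_comm]

theorem bddAbove_norm_total {m : ℕ} {n : Fin m → ℕ} (a : Pattern n) :
    BddAbove (Set.range fun x : Knobs n => ‖total a x‖) := by
  have hc : Continuous fun x : Knobs n => ‖total a x‖ := by
    unfold total
    fun_prop
  exact (isCompact_range hc).bddAbove

theorem norm_total_le_patternValue {m : ℕ} {n : Fin m → ℕ} (a : Pattern n) (x : Knobs n) :
    ‖total a x‖ ≤ patternValue a :=
  le_ciSup (bddAbove_norm_total a) x

theorem exists_circle_mul_eq_norm (w : ℂ) : ∃ u : Circle, (w * u : ℂ) = ‖w‖ := by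
  refine ⟨Circle.exp (-w.arg), ?_⟩
  nth_rewrite 1 [← Complex.norm_mul_exp_arg_mul_I w]
  rw [Circle.coe_exp, mul_assoc, ← Complex.exp_add]
  simp

/-- All directions but `p` are chosen by the preceding lemma; the knobs of `p` rotate each slice sum
onto the positive axis. Unimodular entries give `n_p √(∏_{k ≠ p} n_k) = √(∏ n_k) √n_p`. -/
theorem patternValue_lower_bound {m : ℕ} {n : Fin (m + 1) → ℕ} (a : Pattern n) (p : Fin (m + 1)) :
    (√π / 2) ^ m * (√(∏ k, (n k : ℝ)) * √(n p : ℝ)) ≤ patternValue a := by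
  obtain ⟨x, hx⟩ := exists_knobs_lower_bound
    (fun (i : Fin (n p)) (j : (k : Fin m) → Fin (n (p.succAbove k))) => (a (p.insertNth i j) : ℂ))
  choose u hu using fun i : Fin (n p) => exists_circle_mul_eq_norm
    (∑ j : (k : Fin m) → Fin (n (p.succAbove k)),
      (a (p.insertNth i j) : ℂ) * ∏ k, (x k (j k) : ℂ))
  have htot : total a (Fin.insertNth (α := fun k => Fin (n k) → Circle) p u x) =
      ((∑ i, ‖∑ j : (k : Fin m) → Fin (n (p.succAbove k)),
        (a (p.insertNth i j) : ℂ) * ∏ k, (x k (j k) : ℂ)‖ : ℝ) : ℂ) := by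
    rw [total, sum_eq_sum_insertNth p, Complex.ofReal_sum]
    refine Finset.sum_congr rfl fun i _ => ?_
    rw [← hu, Finset.sum_mul]
    refine Finset.sum_congr rfl fun j _ => ?_
    rw [Fin.prod_univ_succAbove _ p]
    simp only [Fin.insertNth_apply_same, Fin.insertNth_apply_succAbove]
    ring
  refine le_trans ?_ (norm_total_le_patternValue a
    (Fin.insertNth (α := fun k => Fin (n k) → Circle) p u x))
  rw [htot, Complex.norm_real, norm_of_nonneg (by positivity)]
  refine le_trans (le_of_eq ?_) hx
  simp only [Circle.norm_coe, one_pow, Finset.sum_const, Finset.card_univ, Fintype.card_fin,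
    Fintype.card_pi, nsmul_eq_mul, mul_one]
  rw [Fin.prod_univ_succAbove _ p, sqrt_mul (Nat.cast_nonneg _)]
  push_cast
  have := mul_self_sqrt (Nat.cast_nonneg (α := ℝ) (n p))
  linear_combination ((√π / 2) ^ m * √(∏ k, (n (p.succAbove k) : ℝ))) * this

/-! ### The multilinear norm, and attainment of the minimum -/

theorem exists_circle_add_eq {z : ℂ} (hz : ‖z‖ ≤ 1) :
    ∃ u v : Circle, (u : ℂ) + v = 2 * z := by
  refine ⟨Circle.exp (z.arg + arccos ‖z‖), Circle.exp (z.arg - arccos ‖z‖), ?_⟩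
  have h1 : (2 : ℂ) * ‖z‖ = Complex.exp (arccos ‖z‖ * Complex.I) +
      Complex.exp (-arccos ‖z‖ * Complex.I) := by
    rw [← Complex.two_cos, ← Complex.ofReal_cos,
      cos_arccos (by linarith [norm_nonneg z]) hz]
  rw [Circle.coe_exp, Circle.coe_exp]
  push_cast
  rw [sub_eq_add_neg, add_mul, add_mul, Complex.exp_add, Complex.exp_add, ← mul_add, ← h1]
  nth_rewrite 3 [← Complex.norm_mul_exp_arg_mul_I z]
  ring

theorem form_coe {m : ℕ} {n : Fin m → ℕ} (a : Pattern n) (x : Knobs n) :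
    form a (fun k i => (x k i : ℂ)) = total a x := by
  rw [form_apply, total]

theorem patternValue_nonneg {m : ℕ} {n : Fin m → ℕ} (a : Pattern n) : 0 ≤ patternValue a :=
  Real.iSup_nonneg fun _ => norm_nonneg _

/-- Each `y k i` is the midpoint of two unimodular numbers, so multilinearity makes the value at `y`
an average of `2^m` values at torus points. -/
theorem norm_form_apply_le_of_norm_le_one {m : ℕ} {n : Fin m → ℕ} (a : Pattern n)
    (y : (k : Fin m) → Fin (n k) → ℂ) (hy : ∀ k i, ‖y k i‖ ≤ 1) :
    ‖form a y‖ ≤ patternValue a := by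
  choose u v huv using fun k i => exists_circle_add_eq (hy k i)
  have h2 : (fun k i => (u k i : ℂ)) + (fun k i => (v k i : ℂ)) =
      fun k => (2 : ℂ) • y k := by
    funext k i
    exact huv k i
  have h3 : (2 : ℂ) ^ m * form a y =
      form a ((fun k i => (u k i : ℂ)) + fun k i => (v k i : ℂ)) := by
    rw [h2, ContinuousMultilinearMap.map_smul_univ]
    simp
  rw [ContinuousMultilinearMap.map_add_univ] at h3
  have h4 : ∀ s : Finset (Fin m), ‖form a (s.piecewise (fun k i => (u k i : ℂ))
      fun k i => (v k i : ℂ))‖ ≤ patternValue a := by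
    intro s
    have : s.piecewise (fun k i => (u k i : ℂ)) (fun k i => (v k i : ℂ)) =
        fun k i => ((s.piecewise u v k i : Circle) : ℂ) := by
      funext k i
      by_cases hk : k ∈ s <;> simp [hk]
    rw [this, form_coe]
    exact norm_total_le_patternValue a _
  have h5 : (2 : ℝ) ^ m * ‖form a y‖ ≤ (2 : ℝ) ^ m * patternValue a := by
    calc (2 : ℝ) ^ m * ‖form a y‖ = ‖(2 : ℂ) ^ m * form a y‖ := by simp
      _ ≤ ∑ _s : Finset (Fin m), patternValue a := by
          rw [h3]
          exact norm_sum_le_of_le _ fun s _ => h4 s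
      _ = _ := by simp
  exact le_of_mul_le_mul_left h5 (by positivity)

theorem norm_form {m : ℕ} {n : Fin m → ℕ} (a : Pattern n) : ‖form a‖ = patternValue a := by
  apply le_antisymm
  · refine ContinuousMultilinearMap.opNorm_le_bound (patternValue_nonneg a) fun x => ?_
    have hx : x = fun k => (‖x k‖ : ℂ) • ((‖x k‖⁻¹ : ℝ) : ℂ) • x k := by
      funext k
      rcases eq_or_ne (x k) 0 with h | h
      · simp [h]
      · rw [smul_smul, ← Complex.ofReal_mul, mul_inv_cancel₀ (norm_ne_zero_iff.2 h)]
        simp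
    rw [hx, ContinuousMultilinearMap.map_smul_univ, norm_smul, ← hx, mul_comm]
    have h := norm_form_apply_le_of_norm_le_one a (fun k => ((‖x k‖⁻¹ : ℝ) : ℂ) • x k) (by
      intro k i
      rw [Pi.smul_apply, norm_smul, Complex.norm_real, norm_inv, norm_norm]
      exact inv_mul_le_one_of_le₀ (norm_le_pi_norm (x k) i) (norm_nonneg _))
    refine mul_le_mul h (le_of_eq ?_) (norm_nonneg _) (patternValue_nonneg a)
    simp
  · refine ciSup_le fun x => ?_
    rw [← form_coe]
    refine ((form a).le_opNorm _).trans (mul_le_of_le_one_right (norm_nonneg _) ?_)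
    refine Finset.prod_le_one (fun _ _ => norm_nonneg _) fun k _ => ?_
    exact (pi_norm_le_iff_of_nonneg zero_le_one).2 fun i => (Circle.norm_coe _).le

theorem continuous_patternValue {m : ℕ} {n : Fin m → ℕ} :
    Continuous fun a : Pattern n => patternValue a := by
  simp only [← norm_form]
  unfold form
  fun_prop

theorem isLeast_patternValue {m : ℕ} (n : Fin m → ℕ) :
    IsLeast (Set.range fun a : Pattern n => patternValue a) (gameValue n) := by
  obtain ⟨a, -, ha⟩ := isCompact_univ.exists_isMinOn Set.univ_nonempty
    (continuous_patternValue (n := n)).continuousOn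
  have ha' : ∀ b : Pattern n, patternValue a ≤ patternValue b := fun b => ha (Set.mem_univ b)
  have hbdd : BddBelow (Set.range fun a : Pattern n => patternValue a) :=
    ⟨0, by rintro _ ⟨b, rfl⟩; exact patternValue_nonneg b⟩
  have heq : gameValue n = patternValue a := le_antisymm (ciInf_le hbdd a) (le_ciInf ha')
  refine ⟨⟨a, heq.symm⟩, ?_⟩
  rintro _ ⟨b, rfl⟩
  exact ciInf_le hbdd b

/-! ### Fourier patterns and the upper bound -/

theorem sum_norm_sq_dft_eq {N L : ℕ} (hN : N ≠ 0) (hL : L ≤ N) (b : Fin L → ℂ) :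
    ∑ i : Fin N, ‖∑ l : Fin L, Complex.exp (2 * π * Complex.I / N) ^ ((i : ℕ) * l) * b l‖ ^ 2 =
      N * ∑ l, ‖b l‖ ^ 2 := by
  set ω := Complex.exp (2 * π * Complex.I / N) with hω
  have hprim : IsPrimitiveRoot ω N := Complex.isPrimitiveRoot_exp N hN
  have hω1 : ω * (starRingEnd ℂ) ω = 1 := by
    rw [Complex.mul_conj, Complex.normSq_eq_norm_sq, hprim.norm'_eq_one hN]
    simp
  have orth : ∀ l l' : Fin L, ∑ i : Fin N, ω ^ ((i : ℕ) * l) *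
      (starRingEnd ℂ) (ω ^ ((i : ℕ) * l')) = if l = l' then (N : ℂ) else 0 := by
    intro l l'
    have e : ∀ i : Fin N, ω ^ ((i : ℕ) * l) * (starRingEnd ℂ) (ω ^ ((i : ℕ) * l')) =
        (ω ^ (l : ℕ) * (starRingEnd ℂ) ω ^ (l' : ℕ)) ^ (i : ℕ) := by
      intro i
      rw [map_pow, mul_pow, ← pow_mul, ← pow_mul, mul_comm (l : ℕ), mul_comm (l' : ℕ)]
    simp only [e]
    rw [Fin.sum_univ_eq_sum_range (fun i => (ω ^ (l : ℕ) * (starRingEnd ℂ) ω ^ (l' : ℕ)) ^ i)]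
    split_ifs with h
    · subst h
      rw [← mul_pow, hω1]
      simp
    · set x := ω ^ (l : ℕ) * (starRingEnd ℂ) ω ^ (l' : ℕ) with hx
      have hx1 : x ≠ 1 := by
        intro hx1
        apply h
        have : ω ^ (l : ℕ) = ω ^ (l' : ℕ) := by
          calc ω ^ (l : ℕ) = x * ω ^ (l' : ℕ) := by
                rw [hx, mul_assoc, ← mul_pow, mul_comm ((starRingEnd ℂ) ω), hω1]
                simp
            _ = _ := by rw [hx1, one_mul]
        exact Fin.ext (hprim.pow_inj (l.2.trans_le hL) (l'.2.trans_le hL) this)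
      have hxN : x ^ N = 1 := by
        rw [hx, mul_pow, ← pow_mul, ← pow_mul, mul_comm (l : ℕ), mul_comm (l' : ℕ), pow_mul,
          pow_mul, ← map_pow, hprim.pow_eq_one]
        simp
      rw [geom_sum_eq hx1, hxN, sub_self, zero_div]
  rw [← Complex.ofReal_inj]
  push_cast
  have hsq : ∀ z : ℂ, (‖z‖ : ℂ) ^ 2 = z * (starRingEnd ℂ) z := fun z => (Complex.mul_conj' z).symm
  simp only [hsq, map_sum, map_mul, Finset.sum_mul_sum]
  rw [Finset.sum_comm]
  rw [Finset.mul_sum]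
  refine Finset.sum_congr rfl fun l _ => ?_
  rw [Finset.sum_comm]
  have e2 : ∀ l' : Fin L, ∑ i : Fin N, ω ^ ((i : ℕ) * l) * b l *
      ((starRingEnd ℂ) (ω ^ ((i : ℕ) * l')) * (starRingEnd ℂ) (b l')) =
      (if l = l' then (N : ℂ) else 0) * (b l * (starRingEnd ℂ) (b l')) := by
    intro l'
    rw [← orth, Finset.sum_mul]
    refine Finset.sum_congr rfl fun i _ => ?_
    ring
  simp only [e2]
  simp

/-- A pattern for the shorter sides is multiplied by `ω^(j_0 j_1)`, `ω` a primitive `n_0`-th root of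
unity. Since `n_1 ≤ n_0`, the columns are orthogonal of squared norm `n_0`; the unimodular knobs in
direction 1 do not affect the `ℓ²` norm of the inner sums. -/
theorem exists_pattern_of_antitone : ∀ {m : ℕ} (n : Fin (m + 1) → ℕ), Antitone n →
    (∀ k, 1 ≤ n k) → ∃ a : Pattern n, ∀ x : (k : Fin m) → Fin (n (Fin.succAbove 0 k)) → Circle,
      ∑ i : Fin (n 0), ‖∑ j : (k : Fin m) → Fin (n (Fin.succAbove 0 k)),
        (a (Fin.insertNth 0 i j) : ℂ) * ∏ k, (x k (j k) : ℂ)‖ ^ 2 ≤ ∏ k, (n k : ℝ)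
  | 0, n, _, _ => ⟨fun _ => 1, fun x => by
    have h : ∑ j : (k : Fin 0) → Fin (n (Fin.succAbove 0 k)),
        ((1 : Circle) : ℂ) * ∏ k, (x k (j k) : ℂ) = 1 := by
      rw [Fintype.sum_subsingleton _ fun k => k.elim0]
      simp
    simp only [h]
    simp⟩
  | m + 1, n, hn, h1 => by
    obtain ⟨a, ha⟩ := exists_pattern_of_antitone (fun k => n (Fin.succAbove 0 k))
      (fun k l hkl => hn ((Fin.strictMono_succAbove 0).monotone hkl)) (fun k => h1 _)
    have hN : n 0 ≠ 0 := by
      have := h1 0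
      omega
    set ω : Circle := Circle.exp (2 * π / n 0) with hω
    have hωc : (ω : ℂ) = Complex.exp (2 * π * Complex.I / n 0) := by
      rw [hω, Circle.coe_exp]
      push_cast
      ring_nf
    refine ⟨fun j => ω ^ ((j 0 : ℕ) * (j (Fin.succAbove 0 0) : ℕ)) *
      a (fun k => j (Fin.succAbove 0 k)), fun x => ?_⟩
    set Y : Fin (n (Fin.succAbove 0 0)) → ℂ := fun l =>
      ∑ j : (k : Fin m) → Fin (n (Fin.succAbove 0 (Fin.succAbove 0 k))),
        (a (Fin.insertNth (α := fun k => Fin (n (Fin.succAbove 0 k))) 0 l j) : ℂ) *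
          ∏ k, (x (Fin.succAbove 0 k) (j k) : ℂ) with hY
    have hYle : ∑ l, ‖Y l‖ ^ 2 ≤ ∏ k, (n (Fin.succAbove 0 k) : ℝ) :=
      ha (fun k => x (Fin.succAbove 0 k))
    have e : ∀ i : Fin (n 0), ∑ j : (k : Fin (m + 1)) → Fin (n (Fin.succAbove 0 k)),
        ((ω ^ (((Fin.insertNth 0 i j : (k : Fin (m + 2)) → Fin (n k)) 0 : ℕ) *
          ((Fin.insertNth 0 i j : (k : Fin (m + 2)) → Fin (n k)) (Fin.succAbove 0 0) : ℕ)) *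
          a (fun k => (Fin.insertNth 0 i j : (k : Fin (m + 2)) → Fin (n k)) (Fin.succAbove 0 k)) :
          Circle) : ℂ) * ∏ k, (x k (j k) : ℂ) =
        ∑ l : Fin (n (Fin.succAbove 0 0)), Complex.exp (2 * π * Complex.I / n 0) ^
          ((i : ℕ) * (l : ℕ)) * ((x 0 l : ℂ) * Y l) := by
      intro i
      rw [sum_eq_sum_insertNth (n := fun k => n (Fin.succAbove 0 k)) 0]
      refine Finset.sum_congr rfl fun l _ => ?_
      simp only [hY, Finset.mul_sum]
      refine Finset.sum_congr rfl fun j _ => ?_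
      rw [Fin.prod_univ_succAbove _ 0]
      simp only [Fin.insertNth_apply_same, Fin.insertNth_apply_succAbove, Circle.coe_mul,
        Circle.coe_pow, hωc]
      ring
    simp only [e]
    rw [sum_norm_sq_dft_eq hN (hn (Fin.zero_le _)), Fin.prod_univ_succAbove _ 0]
    simp only [norm_mul, Circle.norm_coe, one_mul]
    gcongr

theorem exists_pattern_le_of_antitone {m : ℕ} (n : Fin (m + 1) → ℕ) (hn : Antitone n)
    (h1 : ∀ k, 1 ≤ n k) : ∃ a : Pattern n, ∀ x : Knobs n,
      ‖total a x‖ ≤ √(∏ k, (n k : ℝ)) * √(n 0 : ℝ) := by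
  obtain ⟨a, ha⟩ := exists_pattern_of_antitone n hn h1
  refine ⟨a, fun x => ?_⟩
  have h := ha fun k => x (Fin.succAbove 0 k)
  set y : Fin (n 0) → ℂ := fun i => ∑ j : (k : Fin m) → Fin (n (Fin.succAbove 0 k)),
    (a (Fin.insertNth 0 i j) : ℂ) * ∏ k, (x (Fin.succAbove 0 k) (j k) : ℂ) with hy
  have htot : total a x = ∑ i, (x 0 i : ℂ) * y i := by
    rw [total, sum_eq_sum_insertNth 0]
    refine Finset.sum_congr rfl fun i _ => ?_
    simp only [hy, Finset.mul_sum]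
    refine Finset.sum_congr rfl fun j _ => ?_
    rw [Fin.prod_univ_succAbove _ 0]
    simp only [Fin.insertNth_apply_same, Fin.insertNth_apply_succAbove]
    ring
  have h2 : ‖total a x‖ ≤ ∑ i, ‖y i‖ := by
    rw [htot]
    refine (norm_sum_le _ _).trans (le_of_eq ?_)
    simp only [norm_mul, Circle.norm_coe, one_mul]
  refine h2.trans ?_
  rw [← sqrt_mul (by positivity)]
  apply le_sqrt_of_sq_le
  have h3 := sq_sum_le_card_mul_sum_sq (s := Finset.univ) (f := fun i => ‖y i‖)
  rw [Finset.card_univ, Fintype.card_fin] at h3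
  have h4 := mul_le_mul_of_nonneg_left h (Nat.cast_nonneg (α := ℝ) (n 0))
  linarith

theorem total_comp_perm {m : ℕ} {n : Fin m → ℕ} (σ : Equiv.Perm (Fin m))
    (a : Pattern fun k => n (σ k)) (x : Knobs n) :
    total (fun j : (k : Fin m) → Fin (n k) => a fun k => j (σ k)) x = total a fun k => x (σ k) := by
  rw [total, total]
  refine Fintype.sum_equiv (Equiv.piCongrLeft (fun k => Fin (n k)) σ).symm _ _ fun j => ?_
  congr 1
  exact (Equiv.prod_comp σ fun k => (x k (j k) : ℂ)).symm

theorem exists_pattern_le {m : ℕ} (n : Fin (m + 1) → ℕ) (h1 : ∀ k, 1 ≤ n k) :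
    ∃ (a : Pattern n) (p : Fin (m + 1)), ∀ x : Knobs n,
      ‖total a x‖ ≤ √(∏ k, (n k : ℝ)) * √(n p : ℝ) := by
  -- Sorting in the order dual makes the sides decreasing.
  set σ : Equiv.Perm (Fin (m + 1)) := Tuple.sort fun k => OrderDual.toDual (n k)
  have hσ : Antitone fun k => n (σ k) := Tuple.monotone_sort fun k => OrderDual.toDual (n k)
  obtain ⟨a, ha⟩ := exists_pattern_le_of_antitone (fun k => n (σ k)) hσ fun k => h1 _
  refine ⟨fun j => a fun k => j (σ k), σ 0, fun x => ?_⟩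
  rw [total_comp_perm σ a x, ← Equiv.prod_comp σ fun k => (n k : ℝ)]
  exact ha _

/-! ### Bounds for the normalized quotient -/

theorem le_iSup_sqrt {m : ℕ} (n : Fin m → ℕ) (p : Fin m) : √(n p : ℝ) ≤ ⨆ k, √(n k : ℝ) :=
  le_ciSup (f := fun k => √(n k : ℝ)) (Set.finite_range _).bddAbove p

theorem ratio_denom_pos {m : ℕ} (n : Fin (m + 1) → ℕ) (h1 : ∀ k, 1 ≤ n k) :
    0 < √(∏ k, (n k : ℝ)) * ⨆ k, √(n k : ℝ) := by
  have hpos : ∀ k, (0 : ℝ) < n k := fun k => by exact_mod_cast h1 k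
  refine mul_pos (sqrt_pos.2 (Finset.prod_pos fun k _ => hpos k)) ?_
  exact (sqrt_pos.2 (hpos 0)).trans_le (le_iSup_sqrt n 0)

theorem ratio_le_one {m : ℕ} (n : Fin (m + 1) → ℕ) (h1 : ∀ k, 1 ≤ n k) : ratio n ≤ 1 := by
  obtain ⟨a, p, ha⟩ := exists_pattern_le n h1
  rw [ratio, div_le_one (ratio_denom_pos n h1)]
  have h2 : gameValue n ≤ patternValue a := (isLeast_patternValue n).2 ⟨a, rfl⟩
  refine h2.trans ((ciSup_le ha).trans ?_)
  gcongr
  exact le_iSup_sqrt n p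

theorem le_ratio {m : ℕ} (n : Fin (m + 1) → ℕ) (h1 : ∀ k, 1 ≤ n k) :
    (√π / 2) ^ m ≤ ratio n := by
  obtain ⟨a, ha⟩ := (isLeast_patternValue n).1
  obtain ⟨p, hp⟩ := exists_eq_ciSup_of_finite (f := fun k => √(n k : ℝ))
  rw [ratio, le_div_iff₀ (ratio_denom_pos n h1), ← ha, ← hp]
  exact patternValue_lower_bound a p

/-- A single unimodular entry has modulus 1 in every position of the knobs. This is the witness that
the upper bound cannot be lowered. -/
theorem ratio_one (m : ℕ) : ratio (fun _ : Fin (m + 1) => 1) = 1 := by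
  obtain ⟨a, ha⟩ := (isLeast_patternValue (fun _ : Fin (m + 1) => 1)).1
  have hval : ∀ x : Knobs (fun _ : Fin (m + 1) => 1), ‖total a x‖ = 1 := by
    intro x
    rw [total, Fintype.sum_unique, norm_mul, norm_prod]
    simp only [Circle.norm_coe, Finset.prod_const_one, mul_one]
  have hpv : patternValue a = 1 := by
    rw [patternValue]
    simp only [hval, ciSup_const]
  rw [ratio, ← ha]
  simp [hpv]

end SwitchingGame

theorem theorem1p4 (m : ℕ) (hm : 2 ≤ m) :
    (∀ n : Fin m → ℕ, (∀ k, 1 ≤ n k) →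
      IsLeast (Set.range fun a : SwitchingGame.Pattern n => SwitchingGame.patternValue a)
        (SwitchingGame.gameValue n) ∧
      IsLeast (Set.range fun a : SwitchingGame.Pattern n => ‖SwitchingGame.form a‖)
        (SwitchingGame.gameValue n) ∧
      (√Real.pi / 2) ^ (m - 1) ≤ SwitchingGame.ratio n ∧
      SwitchingGame.ratio n ≤ 1) ∧
    (∀ C : ℝ, (∀ n : Fin m → ℕ, (∀ k, 1 ≤ n k) → SwitchingGame.ratio n ≤ C) → 1 ≤ C) := by
  obtain ⟨m, rfl⟩ : ∃ l, m = l + 1 := ⟨m - 1, by omega⟩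
  refine ⟨fun n hn => ⟨SwitchingGame.isLeast_patternValue n, ?_, SwitchingGame.le_ratio n hn,
    SwitchingGame.ratio_le_one n hn⟩, fun C hC => ?_⟩
  · simp only [SwitchingGame.norm_form]
    exact SwitchingGame.isLeast_patternValue n
  · rw [← SwitchingGame.ratio_one m]
    exact hC _ fun _ => le_rfl
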